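/- Let $F$ be a finite field and $E/F$ a quadratic field extension. Embed $\mathrm{GL}_2(E)$ in $\mathrm{GL}_4(F)$ by choosing an $F$-basis of the $4$-dimensional $F$-vector space $E\oplus E$. Let $P_{2,2}\subset \mathrm{GL}_4(F)$ be the subgroup of block upper triangular matrices $\begin{pmatrix} A & X\\ 0 & D\end{pmatrix}$ with $A, D\in \mathrm{GL}_2(F)$ and $X\in M_2(F)$. Let $\sigma_1,\sigma_2$ be irreducible complex representations of $\mathrm{GL}_2(F)$, regard $\sigma_1\otimes\sigma_2$ as a representation of $P_{2,2}$ through $\begin{pmatrix} A & X\\ 0 & D\end{pmatrix}\mapsto \sigma_1(A)\otimes\sigma_2(D)$, and let $\pi=\mathrm{Ind}_{P_{2,2}}^{\mathrm{GL}_4(F)}(\sigma_1\otimes\sigma_2)$. If $\pi$ is irreducible, then $$\dim_{\mathbb C}\mathrm{Hom}_{\mathrm{GL}_2(E)}(\pi,\chi)\le 1$$ for every character $\chi:\mathrm{GL}_2(E)\to\mathbb C^\times$. -/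

import Mathlib

open scoped MatrixGroups

noncomputable section

namespace GLFour

/-- The standard parabolic subgroup `P_{2,2}` of `GL_4(F)`: the invertible block upper triangular
matrices with two diagonal blocks of size `2 × 2`. Rows and columns of `4 × 4` matrices are indexed
by `Fin 2 ⊕ Fin 2`. -/
def P22 (F : Type*) [Field F] : Subgroup (GL (Fin 2 ⊕ Fin 2) F) where
  carrier := {g | g.val.toBlocks₂₁ = 0}
  one_mem' := by
    ext i j
    simp [Matrix.toBlocks₂₁]
  mul_mem' := by
    intro a b ha hb
    simp only [Set.mem_ofPred_eq] at ha hb ⊢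
    rw [Units.val_mul, ← Matrix.fromBlocks_toBlocks a.val, ← Matrix.fromBlocks_toBlocks b.val,
      Matrix.fromBlocks_multiply, Matrix.toBlocks_fromBlocks₂₁, ha, hb]
    simp
  inv_mem' := by
    intro a ha
    simp only [Set.mem_ofPred_eq] at ha ⊢
    have h : (a⁻¹).val * a.val = 1 := by rw [← Units.val_mul, inv_mul_cancel, Units.val_one]
    rw [← Matrix.fromBlocks_toBlocks a.val, ← Matrix.fromBlocks_toBlocks (a⁻¹).val,
      Matrix.fromBlocks_multiply, ← Matrix.fromBlocks_one, Matrix.fromBlocks_inj, ha] at h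
    obtain ⟨h11, -, h21, -⟩ := h
    simp only [Matrix.mul_zero, add_zero] at h11 h21
    have h' := mul_eq_one_comm.mp h11
    calc (a⁻¹).val.toBlocks₂₁
        = (a⁻¹).val.toBlocks₂₁ * (a.val.toBlocks₁₁ * (a⁻¹).val.toBlocks₁₁) := by
          rw [h', Matrix.mul_one]
      _ = 0 := by rw [← Matrix.mul_assoc, h21, Matrix.zero_mul]

/-- The upper left diagonal block, as a homomorphism `P_{2,2} → GL_2(F)`. -/
def leviFst (F : Type*) [Field F] : P22 F →* GL (Fin 2) F :=
  MonoidHom.toHomUnits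
    { toFun := fun p => p.val.val.toBlocks₁₁
      map_one' := by
        ext i j
        simp [Matrix.toBlocks₁₁, Matrix.one_apply]
      map_mul' := by
        intro a b
        have hb : b.val.val.toBlocks₂₁ = 0 := b.property
        rw [Subgroup.coe_mul, Units.val_mul, ← Matrix.fromBlocks_toBlocks a.val.val,
          ← Matrix.fromBlocks_toBlocks b.val.val, Matrix.fromBlocks_multiply]
        simp only [Matrix.toBlocks_fromBlocks₁₁, hb, Matrix.mul_zero, add_zero] }

/-- The lower right diagonal block, as a homomorphism `P_{2,2} → GL_2(F)`. -/
def leviSnd (F : Type*) [Field F] : P22 F →* GL (Fin 2) F :=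
  MonoidHom.toHomUnits
    { toFun := fun p => p.val.val.toBlocks₂₂
      map_one' := by
        ext i j
        simp [Matrix.toBlocks₂₂, Matrix.one_apply]
      map_mul' := by
        intro a b
        have ha : a.val.val.toBlocks₂₁ = 0 := a.property
        rw [Subgroup.coe_mul, Units.val_mul, ← Matrix.fromBlocks_toBlocks a.val.val,
          ← Matrix.fromBlocks_toBlocks b.val.val, Matrix.fromBlocks_multiply]
        simp only [Matrix.toBlocks_fromBlocks₂₂, ha, Matrix.zero_mul, zero_add] }

/-- The representation `σ₁ ⊗ σ₂` of the Levi subgroup `GL_2(F) × GL_2(F)`, inflated to `P_{2,2}`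
(trivial on the unipotent radical). -/
def inflation {F : Type*} [Field F] {V₁ V₂ : Type*} [AddCommGroup V₁] [Module ℂ V₁]
    [AddCommGroup V₂] [Module ℂ V₂] (σ₁ : Representation ℂ (GL (Fin 2) F) V₁)
    (σ₂ : Representation ℂ (GL (Fin 2) F) V₂) :
    Representation ℂ (P22 F) (TensorProduct ℂ V₁ V₂) :=
  Representation.tprod (σ₁.comp (leviFst F)) (σ₂.comp (leviSnd F))

/-- The parabolically induced representation `Ind_{P_{2,2}}^{GL_4(F)} (σ₁ ⊗ σ₂)`. -/
def parabolicInd {F : Type*} [Field F] {V₁ V₂ : Type*} [AddCommGroup V₁] [Module ℂ V₁]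
    [AddCommGroup V₂] [Module ℂ V₂] (σ₁ : Representation ℂ (GL (Fin 2) F) V₁)
    (σ₂ : Representation ℂ (GL (Fin 2) F) V₂) :
    Representation ℂ (GL (Fin 2 ⊕ Fin 2) F)
      (Representation.IndV (P22 F).subtype (inflation σ₁ σ₂)) :=
  Representation.ind (P22 F).subtype (inflation σ₁ σ₂)

/-- The embedding `GL_2(E) → GL_4(F)` given by an `F`-basis `b` of `E ⊕ E`: it sends `g` to the
matrix in the basis `b` of the `F`-linear map `v ↦ g v`. -/
def embGL {F E : Type*} [Field F] [Field E] [Algebra F E]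
    (b : Module.Basis (Fin 2 ⊕ Fin 2) F (Fin 2 → E)) :
    GL (Fin 2) E →* GL (Fin 2 ⊕ Fin 2) F :=
  Units.map
    { toFun := fun g => LinearMap.toMatrix b b ((Matrix.toLin' g).restrictScalars F)
      map_one' := by
        rw [Matrix.toLin'_one]
        exact LinearMap.toMatrix_id b
      map_mul' := by
        intro g h
        rw [Matrix.toLin'_mul, ← LinearMap.toMatrix_comp b b b]
        rfl }

/-- A character `χ : G → ℂˣ`, viewed as a one-dimensional representation on `ℂ`. -/
def charRep {G : Type*} [Group G] (χ : G →* ℂˣ) : Representation ℂ G ℂ where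
  toFun g := (χ g : ℂ) • LinearMap.id
  map_one' := by ext; simp
  map_mul' g h := by ext; simp [mul_comm]

end GLFour

end

/-! A plane of `E ⊕ E` over `F` either generates `E ⊕ E` over `E` or is a line over `E`, and
`GL_2(E)` is transitive on each kind. By Mackey theory an equivariant functional on `π` is therefore
determined by two pairings of `σ₁` with `σ₂` (`eq_zero_of_evalForm`). As `χ = ψ ∘ det`
(`char_eq_detChar`), the pairing of the open orbit transforms under the diagonal `GL_2(F)` by `ψ ∘
det`, that of the closed orbit under `E^× × E^×` by `ψ ⊗ ψ`. Each is unique up to a scalar: the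
first by Schur's lemma (`form_unique`), the second because every character of the nonsplit torus
`E^×` has multiplicity at most one in an irreducible representation of `GL_2(F)`, by Gelfand's trick
(`isotypicSum_rank_le_one`).

This alone bounds the dimension by two; irreducibility of `π` prevents both pairings from occurring.
The first makes `σ₂` the twist of the dual of `σ₁` by `ψ ∘ det`; the second gives `σ₁` and `σ₂` the
central character `ψ|F^×`. Since the dual of a representation of `GL_2(F)` is its twist by the
inverse central character, `σ₁ ≅ σ₂`; `exists_equiv_of_forms` obtains this directly from matrix
coefficients. But then exchanging the tensor factors yields a non-scalar endomorphism of `π`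
supported on the big cell (`not_irreducible_of_equiv`). -/

noncomputable section

namespace GLFour

open Representation

/-! ### Irreducible representations and matrix coefficients -/

section General

variable {G V W : Type*} [Group G] [AddCommGroup V] [Module ℂ V] [AddCommGroup W] [Module ℂ W]
  {ρ : Representation ℂ G V} {σ : Representation ℂ G W}

/-- A nonzero invariant subspace of an irreducible representation is everything. -/
lemma eq_top_of_invariant (hρ : ρ.IsIrreducible) (S : Submodule ℂ V)
    (hS : ∀ g, ∀ v ∈ S, ρ g v ∈ S) {v : V} (hv : v ∈ S) (hv0 : v ≠ 0) : S = ⊤ := by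
  let S' : Subrepresentation ρ := ⟨S, fun g v hv => hS g v hv⟩
  rcases hρ.eq_bot_or_eq_top S' with h | h
  · exfalso
    have : v ∈ (⊥ : Subrepresentation ρ).toSubmodule := h ▸ hv
    exact hv0 ((Submodule.mem_bot ℂ).mp this)
  · exact congrArg Subrepresentation.toSubmodule h

lemma span_orbit_eq_top (hρ : ρ.IsIrreducible) {v : V} (hv0 : v ≠ 0) :
    Submodule.span ℂ (Set.range fun g => ρ g v) = ⊤ := by
  refine eq_top_of_invariant hρ _ (fun g w hw => ?_)
    (Submodule.subset_span ⟨1, by simp⟩) hv0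
  induction hw using Submodule.span_induction with
  | mem x hx =>
    obtain ⟨h, rfl⟩ := hx
    exact Submodule.subset_span ⟨g * h, by simp⟩
  | zero => simp
  | add x y _ _ hx hy => rw [map_add]; exact Submodule.add_mem _ hx hy
  | smul a x _ hx => rw [map_smul]; exact Submodule.smul_mem _ a hx

/-- Two linear maps that agree on the orbit of a nonzero vector of an irreducible representation
are equal. -/
lemma ext_on_orbit (hρ : ρ.IsIrreducible) {v : V} (hv0 : v ≠ 0) {f f' : V →ₗ[ℂ] W}
    (h : ∀ g, f (ρ g v) = f' (ρ g v)) : f = f' :=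
  LinearMap.ext_on (span_orbit_eq_top hρ hv0) (by rintro _ ⟨g, rfl⟩; exact h g)

lemma nontrivial_of_irreducible (hρ : ρ.IsIrreducible) : Nontrivial V := by
  by_contra h
  rw [not_nontrivial_iff_subsingleton] at h
  refine hρ.toNontrivial.exists_pair_ne.elim fun S ⟨S', hS⟩ => hS ?_
  exact Subrepresentation.toSubmodule_injective (Subsingleton.elim _ _)

lemma finiteDimensional_of_irreducible [Finite G] (hρ : ρ.IsIrreducible) :
    FiniteDimensional ℂ V := by
  have := nontrivial_of_irreducible hρ
  obtain ⟨v, hv⟩ := exists_ne (0 : V)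
  have := Module.Finite.span_of_finite ℂ (Set.finite_range fun g => ρ g v)
  rw [span_orbit_eq_top hρ hv] at this
  exact Module.finite_def.mpr (Module.Finite.iff_fg.mp this)

/-- Irreducible representations with a common nonzero matrix coefficient are isomorphic. -/
lemma exists_equiv_of_matrixCoeff_eq (hρ : ρ.IsIrreducible) (hσ : σ.IsIrreducible)
    (l : V →ₗ[ℂ] ℂ) (v : V) (l' : W →ₗ[ℂ] ℂ) (w : W)
    (h : ∀ g, l (ρ g v) = l' (σ g w)) {g₀ : G} (hg₀ : l (ρ g₀ v) ≠ 0) :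
    ∃ A : V ≃ₗ[ℂ] W, ∀ g x, A (ρ g x) = σ g (A x) := by
  have hv : v ≠ 0 := by rintro rfl; simp at hg₀
  have hw : w ≠ 0 := by rintro rfl; rw [h] at hg₀; simp at hg₀
  let c : V →ₗ[ℂ] (G → ℂ) := LinearMap.pi fun g => l ∘ₗ ρ g
  let c' : W →ₗ[ℂ] (G → ℂ) := LinearMap.pi fun g => l' ∘ₗ σ g
  have hc : Function.Injective c := by
    rw [← LinearMap.ker_eq_bot]
    by_contra hk
    obtain ⟨x, hx, hx0⟩ := Submodule.exists_mem_ne_zero_of_ne_bot hk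
    have hx' : ∀ g, l (ρ g x) = 0 := fun g => congrFun (LinearMap.mem_ker.mp hx) g
    have : l = 0 := ext_on_orbit hρ hx0 (by simpa using hx')
    simp [this] at hg₀
  have hc' : Function.Injective c' := by
    rw [← LinearMap.ker_eq_bot]
    by_contra hk
    obtain ⟨x, hx, hx0⟩ := Submodule.exists_mem_ne_zero_of_ne_bot hk
    have hx' : ∀ g, l' (σ g x) = 0 := fun g => congrFun (LinearMap.mem_ker.mp hx) g
    have : l' = 0 := ext_on_orbit hσ hx0 (by simpa using hx')
    rw [h] at hg₀
    simp [this] at hg₀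
  -- Both images are spanned by the translates of the same function, the common coefficient.
  have hr : LinearMap.range c = LinearMap.range c' := by
    rw [← Submodule.map_top, ← Submodule.map_top, ← span_orbit_eq_top hρ hv,
      ← span_orbit_eq_top hσ hw, Submodule.map_span, Submodule.map_span, ← Set.range_comp,
      ← Set.range_comp]
    congr 2
    ext g k
    have := h (k * g)
    simpa [c, c'] using this
  let A : V ≃ₗ[ℂ] W := (LinearEquiv.ofInjective c hc).trans
    ((LinearEquiv.ofEq _ _ hr).trans (LinearEquiv.ofInjective c' hc').symm)
  have hA : ∀ x, c' (A x) = c x := by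
    intro x
    have : LinearEquiv.ofInjective c' hc' (A x)
      = LinearEquiv.ofEq _ _ hr (LinearEquiv.ofInjective c hc x) := by simp [A]
    have := congrArg Subtype.val this
    simpa using this
  refine ⟨A, fun g x => hc' ?_⟩
  rw [hA]
  funext k
  have := congrFun (hA x) (k * g)
  simpa [c, c'] using this.symm

end General

/-! ### Schur's lemma for semi-invariant pairings -/

section Forms

variable {G V W : Type*} [Group G] [AddCommGroup V] [Module ℂ V] [AddCommGroup W] [Module ℂ W]
  {ρ : Representation ℂ G V} {σ : Representation ℂ G W} {χ : G →* ℂˣ}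

lemma form_injective (hρ : ρ.IsIrreducible) {B : V →ₗ[ℂ] W →ₗ[ℂ] ℂ}
    (hB : ∀ g x y, B (ρ g x) (σ g y) = χ g * B x y) (hB0 : B ≠ 0) : Function.Injective B := by
  rw [← LinearMap.ker_eq_bot]
  by_contra hk
  obtain ⟨x, hx, hx0⟩ := Submodule.exists_mem_ne_zero_of_ne_bot hk
  refine hB0 (LinearMap.ker_eq_top.mp (eq_top_of_invariant hρ _ (fun g v hv => ?_) hx hx0))
  rw [LinearMap.mem_ker] at hv ⊢
  ext y
  have := hB g v (σ g⁻¹ y)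
  simpa [hv] using this

lemma form_flip_injective (hσ : σ.IsIrreducible) {B : V →ₗ[ℂ] W →ₗ[ℂ] ℂ}
    (hB : ∀ g x y, B (ρ g x) (σ g y) = χ g * B x y) (hB0 : B ≠ 0) :
    Function.Injective B.flip :=
  form_injective (σ := ρ) (χ := χ) hσ (fun g x y => by simpa using hB g y x)
    (fun h => hB0 (by ext x y; simpa using LinearMap.congr_fun₂ h y x))

/-- A semi-invariant pairing of two irreducible representations is unique up to a scalar. -/
lemma form_unique [Finite G] (hρ : ρ.IsIrreducible) (hσ : σ.IsIrreducible)
    {B B' : V →ₗ[ℂ] W →ₗ[ℂ] ℂ} (hB : ∀ g x y, B (ρ g x) (σ g y) = χ g * B x y)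
    (hB' : ∀ g x y, B' (ρ g x) (σ g y) = χ g * B' x y) (hB0 : B ≠ 0) :
    ∃ r : ℂ, r • B = B' := by
  have := finiteDimensional_of_irreducible hρ
  have := finiteDimensional_of_irreducible hσ
  have := nontrivial_of_irreducible hρ
  have h1 := form_injective hρ hB hB0
  have h2 := form_flip_injective hσ hB hB0
  have e1 : Module.finrank ℂ V ≤ Module.finrank ℂ W := by
    rw [← Subspace.dual_finrank_eq (V := W)]
    exact LinearMap.finrank_le_finrank_of_injective h1
  have e2 : Module.finrank ℂ W ≤ Module.finrank ℂ V := by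
    rw [← Subspace.dual_finrank_eq (V := V)]
    exact LinearMap.finrank_le_finrank_of_injective h2
  have e : Module.finrank ℂ V = Module.finrank ℂ (W →ₗ[ℂ] ℂ) :=
    (le_antisymm e1 e2).trans (Subspace.dual_finrank_eq (V := W)).symm
  let e' := LinearEquiv.ofInjectiveOfFinrankEq B h1 e
  -- `B` identifies `V` with the dual of `W`, so `B'` becomes an endomorphism of `V`. An eigenvector
  -- lies in the kernel of the semi-invariant pairing `μ • B - B'`, which must then vanish.
  obtain ⟨μ, hμ⟩ := Module.End.exists_eigenvalue (e'.symm.toLinearMap ∘ₗ B' : Module.End ℂ V)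
  obtain ⟨x, hx⟩ := hμ.exists_hasEigenvector
  have hx1 : B' x = μ • B x := by
    have := congrArg e' hx.apply_eq_smul
    rw [map_smul, LinearMap.comp_apply, LinearEquiv.coe_coe, LinearEquiv.apply_symm_apply] at this
    exact this
  refine ⟨μ, ?_⟩
  by_contra hne
  refine hx.2 (form_injective hρ (σ := σ) (χ := χ) (B := μ • B - B') (fun g x y => ?_)
    (sub_ne_zero.mpr hne) ?_)
  · simp only [LinearMap.sub_apply, LinearMap.smul_apply, hB, hB', smul_eq_mul]
    ring
  · simp [hx1]

end Forms

/-! ### Gelfand's trick for a character of a commutative subgroup -/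

section Gelfand

variable {G T V : Type*} [Group G] [CommGroup T] [Fintype T] [AddCommGroup V] [Module ℂ V]

/-- The unnormalised projector onto the `ψ`-isotypic part of `ρ` restricted along `m`. -/
def isotypicSum (ρ : Representation ℂ G V) (m : T →* G) (ψ : T →* ℂˣ) : Module.End ℂ V :=
  ∑ t, ((ψ t⁻¹ : ℂˣ) : ℂ) • ρ (m t)

variable {ρ : Representation ℂ G V} {m : T →* G} {ψ : T →* ℂˣ}

lemma rho_mul_isotypicSum (s : T) :
    ρ (m s) * isotypicSum ρ m ψ = (ψ s : ℂ) • isotypicSum ρ m ψ := by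
  rw [isotypicSum, Finset.mul_sum, Finset.smul_sum]
  refine Fintype.sum_equiv (Equiv.mulLeft s) _ _ fun t => ?_
  simp [smul_smul, mul_comm]

lemma isotypicSum_mul_rho (s : T) :
    isotypicSum ρ m ψ * ρ (m s) = (ψ s : ℂ) • isotypicSum ρ m ψ := by
  rw [← rho_mul_isotypicSum, isotypicSum, Finset.sum_mul, Finset.mul_sum]
  refine Finset.sum_congr rfl fun t _ => ?_
  rw [smul_mul_assoc, mul_smul_comm, ← map_mul, ← map_mul, ← map_mul, ← map_mul, mul_comm]

lemma rho_isotypicSum_apply (s : T) (x : V) :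
    ρ (m s) (isotypicSum ρ m ψ x) = (ψ s : ℂ) • isotypicSum ρ m ψ x :=
  LinearMap.congr_fun (rho_mul_isotypicSum s) x

lemma isotypicSum_apply_of_eigen {v : V} (hv : ∀ t, ρ (m t) v = (ψ t : ℂ) • v) :
    isotypicSum ρ m ψ v = (Fintype.card T : ℂ) • v := by
  simp [isotypicSum, hv, smul_smul, ← Nat.cast_smul_eq_nsmul ℂ]

lemma functional_isotypicSum {l : V →ₗ[ℂ] ℂ} (hl : ∀ t x, l (ρ (m t) x) = ψ t * l x) (x : V) :
    l (isotypicSum ρ m ψ x) = (Fintype.card T : ℂ) * l x := by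
  simp [isotypicSum, hl]

lemma isotypicSum_mul_self :
    isotypicSum ρ m ψ * isotypicSum ρ m ψ = (Fintype.card T : ℂ) • isotypicSum ρ m ψ := by
  ext x
  exact isotypicSum_apply_of_eigen fun t => rho_isotypicSum_apply t x

variable {τ : G → G}

/-- Commutativity of the Hecke algebra, by an anti-automorphism that acts on each group element
as conjugation by an element of the torus. -/
lemma hecke_comm (hτ : ∀ g h, τ (g * h) = τ h * τ g) (hm : ∀ t, τ (m t) = m t)
    (hc : ∀ g, ∃ t, τ g = (m t)⁻¹ * g * m t) (g h : G) :
    (isotypicSum ρ m ψ * ρ g * isotypicSum ρ m ψ) * (isotypicSum ρ m ψ * ρ h * isotypicSum ρ m ψ)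
    = (isotypicSum ρ m ψ * ρ h * isotypicSum ρ m ψ) *
      (isotypicSum ρ m ψ * ρ g * isotypicSum ρ m ψ) := by
  set P := isotypicSum ρ m ψ with hP
  -- The two copies of `P` absorb the conjugating elements with factors `ψ t⁻¹` and `ψ t`, which
  -- cancel.
  have hK : ∀ g, P * ρ (τ g) * P = P * ρ g * P := by
    intro g
    obtain ⟨t, ht⟩ := hc g
    rw [ht, ← map_inv, map_mul, map_mul, ← mul_assoc, ← mul_assoc, hP, isotypicSum_mul_rho,
      mul_assoc, rho_mul_isotypicSum]
    simp [smul_smul]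
  have hexp : ∀ g h, P * ρ g * P * ρ h * P
      = ∑ t, ((ψ t⁻¹ : ℂˣ) : ℂ) • (P * ρ (g * m t * h) * P) := by
    intro g h
    conv_lhs => rw [mul_assoc, mul_assoc (P * ρ g)]
    conv_lhs => enter [2, 1]; rw [hP, isotypicSum]
    simp only [Finset.sum_mul, Finset.mul_sum, smul_mul_assoc, mul_smul_comm, map_mul, mul_assoc]
  -- Expanding the middle `P` gives operators `P * ρ (g * m t * h) * P`; by `hK` each is unchanged
  -- by `τ`, which reverses the product.
  have hflip : ∀ g h, P * ρ g * P * ρ h * P = P * ρ (τ h) * P * ρ (τ g) * P := by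
    intro g h
    rw [hexp, hexp]
    refine Finset.sum_congr rfl fun t _ => ?_
    rw [← hK (g * m t * h), hτ, hτ, hm, mul_assoc (τ h)]
  have hsq : ∀ g h, (P * ρ g * P) * (P * ρ h * P)
      = (Fintype.card T : ℂ) • (P * ρ g * P * ρ h * P) := by
    intro g h
    have : (P * ρ g * P) * (P * ρ h * P) = P * ρ g * (P * P) * ρ h * P := by
      simp only [mul_assoc]
    rw [this, hP, isotypicSum_mul_self]
    simp only [mul_smul_comm, smul_mul_assoc]
  rw [hsq, hflip, ← hsq, hK, hK]

/-- Multiplicity one for the torus. -/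
lemma isotypicSum_rank_le_one [Finite G] (hρ : ρ.IsIrreducible)
    (hτ : ∀ g h, τ (g * h) = τ h * τ g) (hm : ∀ t, τ (m t) = m t)
    (hc : ∀ g, ∃ t, τ g = (m t)⁻¹ * g * m t) :
    ∃ v₀, ∀ x, ∃ r : ℂ, isotypicSum ρ m ψ x = r • v₀ := by
  have := finiteDimensional_of_irreducible hρ
  have hcard : (Fintype.card T : ℂ) ≠ 0 := by simp
  set P := isotypicSum ρ m ψ with hP
  set K : G → Module.End ℂ V := fun g => P * ρ g * P with hKdef
  by_cases hP0 : P = 0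
  · exact ⟨0, fun x => ⟨0, by simp [hP0]⟩⟩
  have hcomm : ∀ g h x, K g (K h x) = K h (K g x) := fun g h x =>
    LinearMap.congr_fun (hecke_comm (ρ := ρ) (ψ := ψ) hτ hm hc g h) x
  have hPP : ∀ w ∈ LinearMap.range P, P w = (Fintype.card T : ℂ) • w := by
    rintro _ ⟨x, rfl⟩
    exact LinearMap.congr_fun isotypicSum_mul_self x
  -- the Hecke algebra moves any nonzero vector of the range onto the whole range
  have hgen : ∀ w ∈ LinearMap.range P, w ≠ 0 →
      LinearMap.range P ≤ Submodule.span ℂ (Set.range fun h => K h w) := by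
    intro w hw hw0
    rw [LinearMap.range_eq_map, ← span_orbit_eq_top hρ hw0, Submodule.map_span, Submodule.span_le]
    rintro _ ⟨_, ⟨h, rfl⟩, rfl⟩
    have : P (ρ h w) = (Fintype.card T : ℂ)⁻¹ • K h w := by
      simp [hKdef, hPP w hw, smul_smul, hcard]
    rw [SetLike.mem_coe, this]
    exact Submodule.smul_mem _ _ (Submodule.subset_span ⟨h, rfl⟩)
  have hKr : ∀ g x, K g x ∈ LinearMap.range P := fun g x => ⟨ρ g (P x), rfl⟩
  obtain ⟨u, hu⟩ : ∃ u, P u ≠ 0 := by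
    by_contra! h
    exact hP0 (LinearMap.ext h)
  -- One eigenvector of `K g` generates the range under operators commuting with `K g`, so `K g` is
  -- scalar on the range.
  have hscal : ∀ g, ∃ μ : ℂ, ∀ w ∈ LinearMap.range P, K g w = μ • w := by
    intro g
    have : Nontrivial (LinearMap.range P) := ⟨⟨⟨P u, ⟨u, rfl⟩⟩, 0, fun h => hu (congrArg Subtype.val h)⟩⟩
    obtain ⟨μ, hμ⟩ := Module.End.exists_eigenvalue
      ((K g).restrict (p := LinearMap.range P) (q := LinearMap.range P) fun x _ => hKr g x)
    obtain ⟨w, hw⟩ := hμ.exists_hasEigenvector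
    have hw1 : K g w = μ • (w : V) := congrArg Subtype.val hw.apply_eq_smul
    have hw0 : (w : V) ≠ 0 := fun h => hw.2 (Subtype.ext h)
    refine ⟨μ, fun y hy => ?_⟩
    have hle : Submodule.span ℂ (Set.range fun h => K h w) ≤ Module.End.eigenspace (K g) μ := by
      rw [Submodule.span_le]
      rintro _ ⟨h, rfl⟩
      rw [SetLike.mem_coe, Module.End.mem_eigenspace_iff, hcomm, hw1, map_smul]
    exact Module.End.mem_eigenspace_iff.mp (hle (hgen w w.2 hw0 hy))
  choose μ hμ using hscal
  refine ⟨P u, fun x => ?_⟩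
  have hx := hgen (P u) ⟨u, rfl⟩ hu (x := P x) ⟨x, rfl⟩
  have hsub : Submodule.span ℂ (Set.range fun h => K h (P u)) ≤ Submodule.span ℂ {P u} := by
    rw [Submodule.span_le]
    rintro _ ⟨h, rfl⟩
    exact Submodule.mem_span_singleton.mpr ⟨μ h, (hμ h _ ⟨u, rfl⟩).symm⟩
  obtain ⟨r, hr⟩ := Submodule.mem_span_singleton.mp (hsub hx)
  exact ⟨r, hr.symm⟩

end Gelfand

/-! ### The nonsplit torus of `GL_2(F)` and its anti-involution -/

section Torus

variable {F E : Type*} [Field F] [Field E] [Algebra F E]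

/-- A quadratic extension has a basis `1, θ`, and `θ` satisfies a quadratic equation. -/
lemma exists_quadratic_basis (hE : Module.finrank F E = 2) :
    ∃ (e : Module.Basis (Fin 2) F E) (t n : F), e 0 = 1 ∧ e 1 * e 1 = t • e 1 - n • (1 : E) := by
  have : FiniteDimensional F E := Module.finite_of_finrank_eq_succ hE
  obtain ⟨θ, hθ⟩ : ∃ θ : E, θ ∉ Submodule.span F {(1 : E)} := by
    by_contra! h
    have h1 : Submodule.span F {(1 : E)} = ⊤ := eq_top_iff.mpr fun x _ => h x
    have h2 := finrank_span_singleton (K := F) (one_ne_zero (α := E))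
    rw [h1, finrank_top, hE] at h2
    omega
  have hli : LinearIndependent F ![1, θ] := by
    rw [LinearIndependent.pair_iff' one_ne_zero]
    intro a ha
    exact hθ (Submodule.mem_span_singleton.mpr ⟨a, ha⟩)
  let e := basisOfLinearIndependentOfCardEqFinrank hli (by simp [hE])
  have h0 : e 0 = 1 := by simp [e]
  have h := e.sum_repr (e 1 * e 1)
  rw [Fin.sum_univ_two, h0] at h
  refine ⟨e, e.repr (e 1 * e 1) 1, - e.repr (e 1 * e 1) 0, h0, ?_⟩
  rw [neg_smul, sub_neg_eq_add, add_comm]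
  exact h.symm

variable (e : Module.Basis (Fin 2) F E)

/-- The embedding of `E^×` in `GL_2(F)` given by a basis of `E`. -/
def torus : Eˣ →* GL (Fin 2) F := Units.map (Algebra.leftMulMatrix e : E →* Matrix (Fin 2) (Fin 2) F)

/-- The inclusion of units of `F` in units of `E`. -/
abbrev unitsMap (F E : Type*) [Field F] [Field E] [Algebra F E] : Fˣ →* Eˣ :=
  Units.map (algebraMap F E : F →* E)

lemma torus_val (a : Eˣ) : (torus e a).val = Algebra.leftMulMatrix e (a : E) := rfl

lemma torus_unitsMap_val (u : Fˣ) :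
    (torus e (unitsMap F E u)).val = algebraMap F (Matrix (Fin 2) (Fin 2) F) u := by
  rw [torus_val]
  exact AlgHom.commutes _ _

lemma torus_unitsMap_comm (u : Fˣ) (g : GL (Fin 2) F) :
    torus e (unitsMap F E u) * g = g * torus e (unitsMap F E u) := by
  ext1
  rw [Units.val_mul, Units.val_mul, torus_unitsMap_val]
  exact Algebra.commutes _ _

lemma det_torus_unitsMap (u : Fˣ) :
    Matrix.GeneralLinearGroup.det (torus e (unitsMap F E u)) = u ^ 2 := by
  ext1
  rw [Matrix.GeneralLinearGroup.val_det_apply, torus_unitsMap_val]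
  simp [Algebra.algebraMap_eq_smul_one]

/-- The matrix of the nontrivial automorphism `θ ↦ t - θ` in the basis `1, θ`. -/
def conjMatrix (t : F) : GL (Fin 2) F where
  val := !![1, t; 0, -1]
  inv := !![1, t; 0, -1]
  val_inv := by simp [Matrix.one_fin_two]
  inv_val := by simp [Matrix.one_fin_two]

lemma conjMatrix_mul_self (t : F) : conjMatrix t * conjMatrix t = 1 :=
  Units.ext (conjMatrix t).val_inv

/-- The anti-involution `g ↦ c adj(g) c` of `GL_2(F)`. -/
def antiInv (t : F) (g : GL (Fin 2) F) : GL (Fin 2) F :=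
  conjMatrix t * (torus e (unitsMap F E (Matrix.GeneralLinearGroup.det g)) * g⁻¹) * conjMatrix t

lemma antiInv_mul (t : F) (g h : GL (Fin 2) F) :
    antiInv e t (g * h) = antiInv e t h * antiInv e t g := by
  have hc := conjMatrix_mul_self t
  simp only [antiInv, map_mul, mul_inv_rev]
  set zg := torus e (unitsMap F E (Matrix.GeneralLinearGroup.det g))
  set zh := torus e (unitsMap F E (Matrix.GeneralLinearGroup.det h))
  have e1 : zg * zh * (h⁻¹ * g⁻¹) = (zh * h⁻¹) * (zg * g⁻¹) := by
    have h1 : zg * zh = zh * zg := torus_unitsMap_comm e _ _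
    have h2 : zg * h⁻¹ = h⁻¹ * zg := torus_unitsMap_comm e _ _
    rw [h1, mul_assoc, ← mul_assoc zg, h2]
    simp only [mul_assoc]
  rw [e1]
  calc _ = conjMatrix t * (zh * h⁻¹) * 1 * (zg * g⁻¹) * conjMatrix t := by
        simp only [mul_assoc, one_mul]
    _ = _ := by rw [← hc]; simp only [mul_assoc]

/-- The scalar `det g` is written as a torus element in `antiInv` to stay inside the group; times
`g⁻¹` it is the adjugate. -/
lemma antiInv_val (t : F) (g : GL (Fin 2) F) :
    (antiInv e t g).val = (conjMatrix t).val * g.val.adjugate * (conjMatrix t).val := by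
  have : (torus e (unitsMap F E (Matrix.GeneralLinearGroup.det g)) * g⁻¹).val = g.val.adjugate := by
    rw [Units.val_mul, torus_unitsMap_val]
    have h : g.val.adjugate = g.val.adjugate * (g.val * (g⁻¹).val) := by
      rw [← Units.val_mul, mul_inv_cancel, Units.val_one, mul_one]
    rw [h, ← mul_assoc, Matrix.adjugate_mul, Algebra.algebraMap_eq_smul_one,
      Matrix.GeneralLinearGroup.val_det_apply]
  rw [antiInv, Units.val_mul, Units.val_mul, this]

variable {e} {t n : F}

lemma leftMulMatrix_eq (h0 : e 0 = 1) (h1 : e 1 * e 1 = t • e 1 - n • (1 : E)) (x y : F) :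
    Algebra.leftMulMatrix e (x • (1 : E) + y • e 1) = !![x, -n * y; y, x + t * y] := by
  ext i j
  rw [Algebra.leftMulMatrix_eq_repr_mul]
  have c0 : (x • (1 : E) + y • e 1) * e 0 = x • e 0 + y • e 1 := by rw [h0, mul_one]
  have c1 : (x • (1 : E) + y • e 1) * e 1 = (-n * y) • e 0 + (x + t * y) • e 1 := by
    rw [add_mul, smul_mul_assoc, smul_mul_assoc, h1, h0, one_mul]
    simp only [Algebra.smul_def, map_add, map_mul, map_neg]
    ring
  fin_cases j <;> fin_cases i <;> simp [c0, c1]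

lemma exists_coords (h0 : e 0 = 1) (a : E) : ∃ x y : F, a = x • (1 : E) + y • e 1 :=
  ⟨e.repr a 0, e.repr a 1, by rw [← h0, ← Fin.sum_univ_two (f := fun i => e.repr a i • e i),
    e.sum_repr]⟩

/-- The adjugate of multiplication by `a` is multiplication by the Galois conjugate of `a`, and
conjugation by `conjMatrix t` undoes this. -/
lemma antiInv_torus (h0 : e 0 = 1) (h1 : e 1 * e 1 = t • e 1 - n • (1 : E)) (a : Eˣ) :
    antiInv e t (torus e a) = torus e a := by
  ext1
  obtain ⟨x, y, hxy⟩ := exists_coords h0 (a : E)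
  rw [antiInv_val, torus_val, hxy, leftMulMatrix_eq h0 h1, Matrix.adjugate_fin_two]
  ext i j
  fin_cases i <;> fin_cases j <;> simp [conjMatrix, Matrix.mul_apply, Fin.sum_univ_two] <;> ring

/-- The anti-involution acts on each element as conjugation by an element of the torus. -/
lemma exists_antiInv_eq_conj (h0 : e 0 = 1) (h1 : e 1 * e 1 = t • e 1 - n • (1 : E))
    (g : GL (Fin 2) F) : ∃ a : Eˣ, antiInv e t g = (torus e a)⁻¹ * g * torus e a := by
  set M := g.val with hM
  -- With `a = x + y * e 1`, these solve the linear equation `torus e a * antiInv e t g = g * torus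
  -- e a`. The solution degenerates to `0` only if `g` is itself in the torus, where `a = 1` works.
  set x := M 0 1 + M 1 0 * n with hx
  set y := M 1 1 - M 0 0 - M 1 0 * t with hy
  by_cases ha : x • (1 : E) + y • e 1 = 0
  · have hxy := (LinearIndependent.pair_iff (R := F) (x := e 0) (y := e 1)).mp (by
      have hf : ⇑e = ![e 0, e 1] := by ext i; fin_cases i <;> rfl
      exact hf ▸ e.linearIndependent) x y (by rw [h0]; exact ha)
    have hg : M = Algebra.leftMulMatrix e (M 0 0 • (1 : E) + M 1 0 • e 1) := by
      rw [leftMulMatrix_eq h0 h1]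
      ext i j
      fin_cases i <;> fin_cases j
      · rfl
      · simp only [Fin.mk_zero, Fin.mk_one, Matrix.of_apply, Matrix.cons_val]
        linear_combination hxy.1
      · rfl
      · simp only [Fin.mk_one, Matrix.of_apply, Matrix.cons_val]
        linear_combination hxy.2
    have hne : M 0 0 • (1 : E) + M 1 0 • e 1 ≠ 0 := by
      intro h
      rw [h, map_zero] at hg
      exact g.ne_zero hg
    have hg' : g = torus e (Units.mk0 _ hne) := by
      ext1
      rw [torus_val, Units.val_mk0, ← hg]
    exact ⟨1, by rw [map_one, inv_one, one_mul, mul_one, hg', antiInv_torus h0 h1]⟩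
  · refine ⟨Units.mk0 _ ha, ?_⟩
    rw [mul_assoc, eq_inv_mul_iff_mul_eq]
    ext1
    rw [Units.val_mul, Units.val_mul, antiInv_val, torus_val, Units.val_mk0,
      leftMulMatrix_eq h0 h1, Matrix.adjugate_fin_two, ← hM]
    ext i j
    fin_cases i <;> fin_cases j <;>
      simp [conjMatrix, Matrix.mul_apply, Fin.sum_univ_two, hx, hy] <;> ring

/-- The determinant is the norm of `a`, so the torus element on the right is the Galois conjugate of
`a`. -/
lemma conjMatrix_mul_torus (h0 : e 0 = 1) (h1 : e 1 * e 1 = t • e 1 - n • (1 : E)) (a : Eˣ) :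
    conjMatrix t * torus e a
      = torus e (unitsMap F E (Matrix.GeneralLinearGroup.det (torus e a)) * a⁻¹) *
        conjMatrix t := by
  conv_lhs => rw [← antiInv_torus h0 h1 a, antiInv]
  rw [← mul_assoc, ← mul_assoc, conjMatrix_mul_self, one_mul, map_mul, map_inv]

end Torus

/-! ### Uniqueness of torus pairings; comparison of `σ₁` and `σ₂` -/

section Comparison

variable {F E : Type*} [Field F] [Field E] [Algebra F E] [Fintype Eˣ]
  {e : Module.Basis (Fin 2) F E} {t n : F}
  {V₁ V₂ : Type*} [AddCommGroup V₁] [Module ℂ V₁] [AddCommGroup V₂] [Module ℂ V₂]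
  {σ₁ : Representation ℂ (GL (Fin 2) F) V₁} {σ₂ : Representation ℂ (GL (Fin 2) F) V₂}

/-- Multiplicity one for pairings that are equivariant under the torus in each variable. -/
lemma torus_form_unique [Finite F] (h0 : e 0 = 1) (h1 : e 1 * e 1 = t • e 1 - n • (1 : E))
    (hσ₁ : σ₁.IsIrreducible) (hσ₂ : σ₂.IsIrreducible) {ψ₁ ψ₂ : Eˣ →* ℂˣ}
    {L L' : V₁ →ₗ[ℂ] V₂ →ₗ[ℂ] ℂ}
    (hL : ∀ a d x y, L (σ₁ (torus e a) x) (σ₂ (torus e d) y) = ψ₁ a * ψ₂ d * L x y)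
    (hL' : ∀ a d x y, L' (σ₁ (torus e a) x) (σ₂ (torus e d) y) = ψ₁ a * ψ₂ d * L' x y)
    (hL0 : L ≠ 0) : ∃ r : ℂ, r • L = L' := by
  obtain ⟨v₁, hv₁⟩ := isotypicSum_rank_le_one (ψ := ψ₁) hσ₁ (antiInv_mul e t)
    (antiInv_torus h0 h1) (exists_antiInv_eq_conj h0 h1)
  obtain ⟨v₂, hv₂⟩ := isotypicSum_rank_le_one (ψ := ψ₂) hσ₂ (antiInv_mul e t)
    (antiInv_torus h0 h1) (exists_antiInv_eq_conj h0 h1)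
  choose r₁ hr₁ using hv₁
  choose r₂ hr₂ using hv₂
  have hcard : (Fintype.card Eˣ : ℂ) ≠ 0 := by simp
  -- Averaging over the torus in each variable reduces the pairing to its value at `v₁`, `v₂`.
  have key : ∀ {M : V₁ →ₗ[ℂ] V₂ →ₗ[ℂ] ℂ},
      (∀ a d x y, M (σ₁ (torus e a) x) (σ₂ (torus e d) y) = ψ₁ a * ψ₂ d * M x y) →
      ∀ x y, M x y = (Fintype.card Eˣ : ℂ)⁻¹ ^ 2 * (r₁ x * r₂ y) * M v₁ v₂ := by
    intro M hM x y
    have e1 := functional_isotypicSum (ρ := σ₁) (m := torus e) (ψ := ψ₁)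
      (l := M.flip (isotypicSum σ₂ (torus e) ψ₂ y)) (fun a z => by
        have := hM a 1 z (isotypicSum σ₂ (torus e) ψ₂ y)
        simpa using this) x
    have e2 := functional_isotypicSum (ρ := σ₂) (m := torus e) (ψ := ψ₂)
      (l := M x) (fun d z => by
        have := hM 1 d x z
        simpa using this) y
    rw [LinearMap.flip_apply, LinearMap.flip_apply, e2, hr₁, hr₂] at e1
    simp only [map_smul, LinearMap.smul_apply, smul_eq_mul] at e1
    field_simp
    linear_combination -e1
  have hne : L v₁ v₂ ≠ 0 := fun h => hL0 (by ext x y; rw [key hL, h]; simp)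
  refine ⟨L' v₁ v₂ / L v₁ v₂, ?_⟩
  ext x y
  rw [LinearMap.smul_apply, LinearMap.smul_apply, key hL x y, key hL' x y, smul_eq_mul]
  field_simp

/-- `B` turns a coefficient of `σ₁` at `g` into one of `σ₂` at `g⁻¹`. The anti-involution turns
`g⁻¹` back into a torus conjugate of `g`, up to a scalar, and the torus eigenvectors `v₁`, `v₂`
absorb the conjugation. Hence `σ₁` and `σ₂` share a coefficient. -/
lemma exists_equiv_of_forms (h0 : e 0 = 1) (h1 : e 1 * e 1 = t • e 1 - n • (1 : E))
    (hσ₁ : σ₁.IsIrreducible) (hσ₂ : σ₂.IsIrreducible) {ψ : Eˣ →* ℂˣ}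
    {B L : V₁ →ₗ[ℂ] V₂ →ₗ[ℂ] ℂ}
    (hB : ∀ g x y, B (σ₁ g x) (σ₂ g y)
      = ψ (unitsMap F E (Matrix.GeneralLinearGroup.det g)) * B x y)
    (hB0 : B ≠ 0)
    (hL : ∀ a d x y, L (σ₁ (torus e a) x) (σ₂ (torus e d) y) = ψ a * ψ d * L x y)
    (hL0 : L ≠ 0) :
    ∃ A : V₁ ≃ₗ[ℂ] V₂, ∀ g x, A (σ₁ g x) = σ₂ g (A x) := by
  have hcard : (Fintype.card Eˣ : ℂ) ≠ 0 := by simp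
  obtain ⟨x₀, y₀, hxy⟩ : ∃ x y, L x y ≠ 0 := by
    by_contra! h
    exact hL0 (by ext x y; simpa using h x y)
  set v₁ := isotypicSum σ₁ (torus e) ψ x₀ with hv₁
  set v₂ := isotypicSum σ₂ (torus e) ψ y₀ with hv₂
  have hv₁0 : v₁ ≠ 0 := by
    intro h
    have := functional_isotypicSum (ρ := σ₁) (m := torus e) (ψ := ψ) (l := L.flip y₀)
      (fun a z => by simpa using hL a 1 z y₀) x₀
    rw [← hv₁, h, map_zero] at this
    exact mul_ne_zero hcard hxy this.symm
  have hv₂0 : v₂ ≠ 0 := by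
    intro h
    have := functional_isotypicSum (ρ := σ₂) (m := torus e) (ψ := ψ) (l := L x₀)
      (fun a z => by simpa using hL 1 a x₀ z) y₀
    rw [← hv₂, h, map_zero] at this
    exact mul_ne_zero hcard hxy this.symm
  have hev₁ : ∀ a, σ₁ (torus e a) v₁ = (ψ a : ℂ) • v₁ := fun a => rho_isotypicSum_apply a x₀
  have hev₂ : ∀ a, σ₂ (torus e a) v₂ = (ψ a : ℂ) • v₂ := fun a => rho_isotypicSum_apply a y₀
  set c := conjMatrix t with hc
  have hBtorus : ∀ r w, B v₁ (σ₂ (torus e r) w)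
      = ψ (unitsMap F E (Matrix.GeneralLinearGroup.det (torus e r))) * ψ r⁻¹ * B v₁ w := by
    intro r w
    have := hB (torus e r) (σ₁ (torus e r⁻¹) v₁) w
    rw [← Module.End.mul_apply, ← map_mul, ← map_mul, mul_inv_cancel, map_one, map_one,
      Module.End.one_apply, hev₁, map_smul, LinearMap.smul_apply, smul_eq_mul] at this
    rw [this, mul_assoc]
  -- Moving `torus e a` past `c` conjugates `a`; the factor `ψ (N r / r)` of `hBtorus` conjugates it
  -- back.
  have hμ : ∀ a w, B v₁ (σ₂ (c * torus e a) w) = ψ a * B v₁ (σ₂ c w) := by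
    intro a w
    rw [hc, conjMatrix_mul_torus h0 h1, map_mul, Module.End.mul_apply, hBtorus, ← Units.val_mul,
      ← map_mul]
    congr 3
    simp only [map_mul, det_torus_unitsMap, map_inv, map_pow]
    rw [pow_two, mul_inv_cancel_right, mul_inv_rev, inv_inv, mul_comm a, mul_inv_cancel_left]
  have hcoeff : ∀ g, B (σ₁ g v₁) (σ₂ c v₂) = B v₁ (σ₂ c (σ₂ g v₂)) := by
    intro g
    obtain ⟨a, ha⟩ := exists_antiInv_eq_conj h0 h1 g
    set z := unitsMap F E (Matrix.GeneralLinearGroup.det g) with hz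
    -- This is `ha` solved for `g⁻¹ * c`.
    have hgc : g⁻¹ * c = (c * torus e a⁻¹) * (g * (torus e a * torus e z⁻¹)) := by
      have h2 : c * torus e a⁻¹ * g * torus e a = torus e z * (g⁻¹ * c) := by
        rw [map_inv, mul_assoc, mul_assoc, ← mul_assoc _ g, ← ha, antiInv, ← mul_assoc, ← mul_assoc,
          ← mul_assoc, ← hc, hc, conjMatrix_mul_self, one_mul, mul_assoc]
      rw [← mul_assoc, ← mul_assoc, h2, torus_unitsMap_comm, mul_assoc, ← map_mul, mul_inv_cancel,
        map_one, mul_one]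
    have h3 := hB g v₁ (σ₂ (g⁻¹ * c) v₂)
    rw [← Module.End.mul_apply (σ₂ g), ← map_mul, mul_inv_cancel_left] at h3
    rw [h3, hgc, map_mul, Module.End.mul_apply, hμ, map_mul, Module.End.mul_apply, ← map_mul, hev₂,
      map_smul, map_smul, map_smul, smul_eq_mul, ← mul_assoc, ← mul_assoc, ← Units.val_mul,
      ← Units.val_mul, ← map_mul, ← map_mul]
    have : z * a⁻¹ * (a * z⁻¹) = 1 := by group
    rw [this]
    simp
  -- The orbit of `v₁` spans and `B` is nondegenerate, so a vanishing coefficient would force `v₂ =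
  -- 0`.
  have hne : ∃ g, B (σ₁ g v₁) (σ₂ c v₂) ≠ 0 := by
    by_contra! h
    have h4 : B.flip (σ₂ c v₂) = 0 := ext_on_orbit hσ₁ hv₁0 (by simpa using h)
    have hχ : ∀ g x y, B (σ₁ g x) (σ₂ g y)
      = ((ψ.comp ((unitsMap F E).comp Matrix.GeneralLinearGroup.det)) g : ℂˣ) * B x y := hB
    have h5 : σ₂ c v₂ = 0 := form_flip_injective hσ₂ hχ hB0 (by rw [h4, map_zero])
    have h6 := congrArg (σ₂ c) h5
    rw [← Module.End.mul_apply, ← map_mul, hc, conjMatrix_mul_self, map_one, map_zero] at h6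
    exact hv₂0 h6
  obtain ⟨g₀, hg₀⟩ := hne
  exact exists_equiv_of_matrixCoeff_eq hσ₁ hσ₂ (B.flip (σ₂ c v₂)) v₁ (B v₁ ∘ₗ σ₂ c) v₂
    (fun g => hcoeff g) (g₀ := g₀) hg₀

end Comparison

/-! ### Induced representations and Frobenius reciprocity -/

section Induced

variable {G H A B : Type*} [Group G] [Group H] {φ : G →* H} [AddCommGroup A] [Module ℂ A]
  [AddCommGroup B] [Module ℂ B] {ρ : Representation ℂ G A}

lemma indV_mk_mul (p : G) (g : H) (a : A) :
    IndV.mk φ ρ (φ p * g) (ρ p a) = IndV.mk φ ρ g a := by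
  have := Coinvariants.mk_self_apply (Representation.tprod ((leftRegular ℂ H).comp φ) ρ) p
    (TensorProduct.mk ℂ _ _ (MonoidAlgebra.single g 1) a)
  simpa using this

/-- The relations of `indV_mk_mul` are the only ones imposed by the coinvariants, so a compatible
family descends. -/
lemma exists_indV_lift (Ψ : H → A →ₗ[ℂ] B) (h : ∀ p g a, Ψ (φ p * g) (ρ p a) = Ψ g a) :
    ∃ f : IndV φ ρ →ₗ[ℂ] B, ∀ g a, f (IndV.mk φ ρ g a) = Ψ g a := by
  refine ⟨Coinvariants.lift _ (TensorProduct.lift <| (Finsupp.lift _ _ _ Ψ) ∘ₗ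
      (MonoidAlgebra.coeffLinearEquiv ℂ).toLinearMap) fun p => ?_, fun g a => ?_⟩
  · ext g a
    simp only [LinearMap.coe_comp, Function.comp_apply, MonoidAlgebra.lsingle_apply]
    simp [h]
  · simp

/-- An endomorphism of an irreducible representation of a finite group is a scalar. -/
lemma exists_scalar [Finite G] (hρ : ρ.IsIrreducible) (f : A →ₗ[ℂ] A)
    (hf : ∀ g a, f (ρ g a) = ρ g (f a)) : ∃ r : ℂ, ∀ a, f a = r • a := by
  have := finiteDimensional_of_irreducible hρ
  have := nontrivial_of_irreducible hρ
  obtain ⟨μ, hμ⟩ := Module.End.exists_eigenvalue (f : Module.End ℂ A)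
  obtain ⟨x, hx⟩ := hμ.exists_hasEigenvector
  have htop := eq_top_of_invariant hρ (Module.End.eigenspace f μ) (fun g v hv => by
    rw [Module.End.mem_eigenspace_iff] at hv ⊢
    rw [hf, hv, map_smul]) hx.1 hx.2
  exact ⟨μ, fun a => Module.End.mem_eigenspace_iff.mp (htop ▸ Submodule.mem_top)⟩

/-- If the induced representation is irreducible, Frobenius reciprocity leaves only the scalar
multiples of the canonical map into it. -/
lemma exists_scalar_of_ind_irreducible [Finite H] (hirr : (ind φ ρ).IsIrreducible)
    (J : A →ₗ[ℂ] IndV φ ρ) (hJ : ∀ p a, J (ρ p a) = ind φ ρ (φ p) (J a)) :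
    ∃ r : ℂ, ∀ a, J a = r • IndV.mk φ ρ 1 a := by
  -- Frobenius reciprocity extends `J` to an endomorphism of the induced representation, which is a
  -- scalar.
  obtain ⟨f, hf⟩ := exists_indV_lift (φ := φ) (ρ := ρ) (fun g => ind φ ρ g⁻¹ ∘ₗ J)
    (fun p g a => by
      simp only [LinearMap.comp_apply]
      rw [hJ, ← Module.End.mul_apply, ← map_mul]
      simp only [mul_inv_rev, inv_mul_cancel_right])
  obtain ⟨r, hr⟩ := exists_scalar hirr f (fun g z => by
    have : f ∘ₗ ind φ ρ g = ind φ ρ g ∘ₗ f := by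
      refine IndV.hom_ext φ ρ fun h => ?_
      refine LinearMap.ext fun a => ?_
      change f (ind φ ρ g (IndV.mk φ ρ h a)) = ind φ ρ g (f (IndV.mk φ ρ h a))
      rw [ind_mk, hf, hf, LinearMap.comp_apply, LinearMap.comp_apply, mul_inv_rev, inv_inv,
        map_mul, Module.End.mul_apply]
    exact LinearMap.congr_fun this z)
  refine ⟨r, fun a => ?_⟩
  rw [← hr, hf, inv_one, map_one]
  rfl

/-- The component of an induced vector at the trivial coset. -/
lemma exists_indV_component (P : Subgroup H) (ρ : Representation ℂ P A) :
    ∃ f : IndV P.subtype ρ →ₗ[ℂ] A, (∀ a, f (IndV.mk P.subtype ρ 1 a) = a) ∧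
      ∀ g ∉ P, ∀ a, f (IndV.mk P.subtype ρ g a) = 0 := by
  classical
  obtain ⟨f, hf⟩ := exists_indV_lift (φ := P.subtype) (ρ := ρ)
    (fun g => if h : g ∈ P then ρ ⟨g, h⟩⁻¹ else 0) (fun p g a => by
      by_cases h : g ∈ P
      · have h' : P.subtype p * g ∈ P := P.mul_mem p.2 h
        simp only [h, h', dif_pos]
        rw [← Module.End.mul_apply, ← map_mul]
        congr 2
        ext1
        simp
      · have h' : P.subtype p * g ∉ P := fun h' => h ((P.mul_mem_cancel_left p.2).mp h')
        simp only [h, h', dif_neg, not_false_eq_true, LinearMap.zero_apply])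
  refine ⟨f, fun a => ?_, fun g hg a => ?_⟩
  · have h1 : (⟨1, P.one_mem⟩ : P) = 1 := rfl
    rw [hf, dif_pos P.one_mem, h1, inv_one, map_one, Module.End.one_apply]
  · rw [hf, dif_neg hg, LinearMap.zero_apply]

end Induced

/-! ### Block matrices and the big cell -/

section Blocks

variable {F : Type*} [Field F]

/-- Block diagonal elements of `GL_4(F)`. -/
def blockDiag (A D : GL (Fin 2) F) : GL (Fin 2 ⊕ Fin 2) F where
  val := Matrix.fromBlocks A.val 0 0 D.val
  inv := Matrix.fromBlocks (A⁻¹).val 0 0 (D⁻¹).val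
  val_inv := by simp [Matrix.fromBlocks_multiply]
  inv_val := by simp [Matrix.fromBlocks_multiply]

lemma blockDiag_mem (A D : GL (Fin 2) F) : blockDiag A D ∈ P22 F :=
  Matrix.toBlocks_fromBlocks₂₁ _ _ _ _

lemma leviFst_val (p : P22 F) : (leviFst F p).val = p.val.val.toBlocks₁₁ := rfl

lemma leviSnd_val (p : P22 F) : (leviSnd F p).val = p.val.val.toBlocks₂₂ := rfl

lemma leviFst_blockDiag (A D : GL (Fin 2) F) : leviFst F ⟨blockDiag A D, blockDiag_mem A D⟩ = A :=
  Units.ext (Matrix.toBlocks_fromBlocks₁₁ _ _ _ _)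

lemma leviSnd_blockDiag (A D : GL (Fin 2) F) : leviSnd F ⟨blockDiag A D, blockDiag_mem A D⟩ = D :=
  Units.ext (Matrix.toBlocks_fromBlocks₂₂ _ _ _ _)

/-- The unipotent radical of `P_{2,2}`. -/
def unip (X : Matrix (Fin 2) (Fin 2) F) : GL (Fin 2 ⊕ Fin 2) F where
  val := Matrix.fromBlocks 1 X 0 1
  inv := Matrix.fromBlocks 1 (-X) 0 1
  val_inv := by simp [Matrix.fromBlocks_multiply]
  inv_val := by simp [Matrix.fromBlocks_multiply]

/-- The block permutation exchanging the two diagonal blocks. -/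
def blockSwap (F : Type*) [Field F] : GL (Fin 2 ⊕ Fin 2) F where
  val := Matrix.fromBlocks 0 1 1 0
  inv := Matrix.fromBlocks 0 1 1 0
  val_inv := by simp [Matrix.fromBlocks_multiply]
  inv_val := by simp [Matrix.fromBlocks_multiply]

lemma blockSwap_mul_unip_notMem (X : Matrix (Fin 2) (Fin 2) F) :
    blockSwap F * unip X ∉ P22 F := by
  intro h
  have h' : (blockSwap F * unip X).val.toBlocks₂₁ = 0 := h
  simp [blockSwap, unip, Matrix.fromBlocks_multiply] at h'

lemma mem_of_blockSwap_conj {X : Matrix (Fin 2) (Fin 2) F}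
    (h : blockSwap F * unip X * (blockSwap F)⁻¹ ∈ P22 F) : X = 0 := by
  have h' : (blockSwap F * unip X * (blockSwap F)⁻¹).val.toBlocks₂₁ = 0 := h
  have h2 : ((blockSwap F)⁻¹).val = Matrix.fromBlocks 0 1 1 0 := rfl
  rw [Units.val_mul, Units.val_mul, h2] at h'
  simpa [blockSwap, unip, Matrix.fromBlocks_multiply] using h'

/-- Right multiplication by `p⁻¹` permutes the cosets of `P22 F` in the big cell by an affine map of
`X`, at the cost of a Levi factor with its blocks exchanged. -/
lemma blockDiag_mul_blockSwap_mul_unip (p : P22 F) (X : Matrix (Fin 2) (Fin 2) F) :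
    blockDiag (leviSnd F p) (leviFst F p) * (blockSwap F * unip X)
      = blockSwap F * unip (((leviFst F p).val * X - p.val.val.toBlocks₁₂) *
        ((leviSnd F p)⁻¹).val) * p.val := by
  ext1
  have hp : p.val.val = Matrix.fromBlocks (leviFst F p).val p.val.val.toBlocks₁₂ 0
      (leviSnd F p).val := by
    conv_lhs => rw [← Matrix.fromBlocks_toBlocks p.val.val]
    rw [leviFst_val, leviSnd_val, show p.val.val.toBlocks₂₁ = 0 from p.2]
  simp only [Units.val_mul]
  conv_rhs => rw [hp]
  simp only [blockDiag, blockSwap, unip, Matrix.fromBlocks_multiply]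
  simp [-Matrix.coe_units_inv]

end Blocks

/-! ### Reducibility of the representation induced from `σ ⊗ σ` -/

section Reducibility

variable {F : Type*} [Field F] [Finite F]
  {V₁ V₂ : Type*} [AddCommGroup V₁] [Module ℂ V₁] [AddCommGroup V₂] [Module ℂ V₂]
  {σ₁ : Representation ℂ (GL (Fin 2) F) V₁} {σ₂ : Representation ℂ (GL (Fin 2) F) V₂}

/-- The representation induced from `σ ⊗ σ` is reducible: it has an endomorphism supported on the
big cell. -/
theorem not_irreducible_of_equiv [Nontrivial (TensorProduct ℂ V₁ V₂)] (A : V₁ ≃ₗ[ℂ] V₂)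
    (hA : ∀ g x, A (σ₁ g x) = σ₂ g (A x)) : ¬ (parabolicInd σ₁ σ₂).IsIrreducible := by
  classical
  intro hirr
  have : Fintype F := Fintype.ofFinite F
  set w := blockSwap F
  -- Swapping the factors through `A` matches the exchange of Levi blocks caused by `w`.
  let S : TensorProduct ℂ V₁ V₂ ≃ₗ[ℂ] TensorProduct ℂ V₁ V₂ :=
    (TensorProduct.congr A A.symm).trans (TensorProduct.comm ℂ V₂ V₁)
  let ι := fun g => IndV.mk (P22 F).subtype (inflation σ₁ σ₂) g
  have hA' : ∀ g y, A.symm (σ₂ g y) = σ₁ g (A.symm y) := fun g y => by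
    rw [LinearEquiv.symm_apply_eq, hA, LinearEquiv.apply_symm_apply]
  have hS : ∀ (p : P22 F) a,
      inflation σ₁ σ₂ ⟨blockDiag (leviSnd F p) (leviFst F p), blockDiag_mem _ _⟩ (S a)
        = S (inflation σ₁ σ₂ p a) := by
    intro p a
    induction a using TensorProduct.induction_on with
    | zero => simp
    | tmul x y =>
      simp [S, inflation, leviFst_blockDiag, leviSnd_blockDiag, hA, hA']
    | add a b ha hb => simp only [map_add, ha, hb]
  -- The sum runs over the cosets of `P22 F` in the big cell, one for each `X`.
  let J : TensorProduct ℂ V₁ V₂ →ₗ[ℂ] IndV (P22 F).subtype (inflation σ₁ σ₂) :=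
    ∑ X : Matrix (Fin 2) (Fin 2) F, ι (w * unip X) ∘ₗ S.toLinearMap
  have hJ : ∀ p a, J (inflation σ₁ σ₂ p a) = ind _ (inflation σ₁ σ₂) ((P22 F).subtype p) (J a) := by
    intro p a
    simp only [J, LinearMap.sum_apply, map_sum, LinearMap.comp_apply, LinearEquiv.coe_coe]
    have hinv : ((leviFst F p)⁻¹).val * (leviFst F p).val = 1 := Units.inv_mul _
    have hinv' : (leviFst F p).val * ((leviFst F p)⁻¹).val = 1 := Units.mul_inv _
    have hinv2 : ((leviSnd F p)⁻¹).val * (leviSnd F p).val = 1 := Units.inv_mul _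
    have hinv2' : (leviSnd F p).val * ((leviSnd F p)⁻¹).val = 1 := Units.mul_inv _
    symm
    refine Fintype.sum_equiv
      { toFun := fun X => ((leviFst F p).val * X - p.val.val.toBlocks₁₂) * ((leviSnd F p)⁻¹).val
        invFun := fun Y => ((leviFst F p)⁻¹).val * (Y * (leviSnd F p).val + p.val.val.toBlocks₁₂)
        left_inv := fun X => by
          simp only [Matrix.mul_assoc, hinv2, Matrix.mul_one, sub_add_cancel]
          rw [← Matrix.mul_assoc, hinv, Matrix.one_mul]
        right_inv := fun Y => by
          simp only
          rw [← Matrix.mul_assoc, hinv', Matrix.one_mul, add_sub_cancel_right, Matrix.mul_assoc,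
            hinv2', Matrix.mul_one] } _ _ fun X => ?_
    have h1 := blockDiag_mul_blockSwap_mul_unip p X
    change ind _ (inflation σ₁ σ₂) p.val (IndV.mk _ _ (w * unip X) (S a)) = _
    rw [ind_mk, ← indV_mk_mul ⟨blockDiag (leviSnd F p) (leviFst F p), blockDiag_mem _ _⟩, hS]
    change ι (blockDiag (leviSnd F p) (leviFst F p) * (w * unip X * p.val⁻¹)) _ = _
    rw [← mul_assoc, h1, mul_inv_cancel_right]
    rfl
  obtain ⟨r, hr⟩ := exists_scalar_of_ind_irreducible hirr J hJ
  obtain ⟨f, hf1, hf0⟩ := exists_indV_component (P22 F) (inflation σ₁ σ₂)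
  obtain ⟨a, ha⟩ := exists_ne (0 : TensorProduct ℂ V₁ V₂)
  -- The big cell misses the trivial coset, which forces the scalar `r` to be zero.
  have hfJ : f (J a) = 0 := by
    simp only [J, LinearMap.sum_apply, map_sum, LinearMap.comp_apply, LinearEquiv.coe_coe]
    exact Finset.sum_eq_zero fun X _ => hf0 _ (blockSwap_mul_unip_notMem X) _
  have hr0 : r = 0 := by
    rw [hr, map_smul, hf1] at hfJ
    exact (smul_eq_zero.mp hfJ).resolve_right ha
  -- After translation by `w` only the summand `X = 0` lies over the trivial coset, so `J a` is not
  -- zero.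
  have hfw : f (ind _ (inflation σ₁ σ₂) w (J a)) = S a := by
    simp only [J, LinearMap.sum_apply, map_sum, LinearMap.comp_apply, LinearEquiv.coe_coe]
    rw [Finset.sum_eq_single 0]
    · change f (ind _ (inflation σ₁ σ₂) w (IndV.mk _ _ (w * unip 0) (S a))) = _
      have h0 : unip (0 : Matrix (Fin 2) (Fin 2) F) = 1 := Units.ext Matrix.fromBlocks_one
      rw [ind_mk, h0, mul_one, mul_inv_cancel, hf1]
    · intro X _ hX
      change f (ind _ (inflation σ₁ σ₂) w (IndV.mk _ _ (w * unip X) (S a))) = _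
      rw [ind_mk]
      exact hf0 _ (fun h => hX (mem_of_blockSwap_conj h)) _
    · simp
  rw [hr, hr0, zero_smul, map_zero, map_zero] at hfw
  exact ha (S.map_eq_zero_iff.mp hfw.symm)

end Reducibility

/-! ### Characters of `GL_2(E)` -/

section Character

variable {E : Type*} [Field E]

/-- Diagonal matrices in `GL_2(E)`. -/
def diagGL : (Eˣ × Eˣ) →* GL (Fin 2) E where
  toFun a :=
    { val := !![(a.1 : E), 0; 0, (a.2 : E)]
      inv := !![(a.1⁻¹ : Eˣ), 0; 0, (a.2⁻¹ : Eˣ)]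
      val_inv := by simp [Matrix.one_fin_two]
      inv_val := by simp [Matrix.one_fin_two] }
  map_one' := by ext1; simp [Matrix.one_fin_two]
  map_mul' a b := by ext1; simp

/-- A character of `GL_2(E)` restricted to the matrices `diag(a, 1)`. -/
def detChar (χ : GL (Fin 2) E →* ℂˣ) : Eˣ →* ℂˣ :=
  (χ.comp diagGL).comp (MonoidHom.inl Eˣ Eˣ)

lemma detChar_apply (χ : GL (Fin 2) E →* ℂˣ) (a : Eˣ) : detChar χ a = χ (diagGL (a, 1)) := rfl

lemma map_conj_eq {G A : Type*} [Group G] [CommGroup A] (χ : G →* A) (g h : G) :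
    χ (g * h * g⁻¹) = χ h := by
  rw [map_mul, map_mul, map_inv, mul_comm, inv_mul_cancel_left]

lemma char_diagGL (χ : GL (Fin 2) E →* ℂˣ) (a d : Eˣ) :
    χ (diagGL (a, d)) = detChar χ a * detChar χ d := by
  let w : GL (Fin 2) E :=
    { val := !![0, 1; 1, 0]
      inv := !![0, 1; 1, 0]
      val_inv := by simp [Matrix.one_fin_two]
      inv_val := by simp [Matrix.one_fin_two] }
  have h1 : diagGL (1, d) = w * diagGL (d, 1) * w⁻¹ := by
    ext1
    have hw : (w⁻¹).val = !![0, 1; 1, 0] := rfl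
    rw [Units.val_mul, Units.val_mul, hw]
    simp [w, diagGL]
  have h2 : diagGL (a, d) = diagGL (a, 1) * diagGL (1, d) := by
    rw [← map_mul]; simp
  rw [h2, map_mul, h1, map_conj_eq, detChar_apply, detChar_apply]

/-- Transvections as invertible matrices. -/
def transvectionGL (i j : Fin 2) (hij : i ≠ j) (c : E) : GL (Fin 2) E where
  val := Matrix.transvection i j c
  inv := Matrix.transvection i j (-c)
  val_inv := by simp [Matrix.transvection_mul_transvection_same _ _ hij]
  inv_val := by simp [Matrix.transvection_mul_transvection_same _ _ hij]

/-- A diagonal conjugation multiplies the parameter by `θ`, so `χ` is trivial on parameters of the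
form `(θ - 1) * c`; as `θ ≠ 1`, these are all of `E`. -/
lemma char_transvectionGL (χ : GL (Fin 2) E →* ℂˣ) {θ : E} (h0 : θ ≠ 0) (h1 : θ ≠ 1)
    (i j : Fin 2) (hij : i ≠ j) (c : E) : χ (transvectionGL i j hij c) = 1 := by
  have hconj : ∀ c : E, ∃ g : GL (Fin 2) E, transvectionGL i j hij (θ * c) * g
      = g * transvectionGL i j hij c := by
    intro c
    fin_cases i <;> fin_cases j
    · exact absurd rfl hij
    · refine ⟨diagGL (Units.mk0 θ h0, 1), ?_⟩
      ext1
      ext k l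
      fin_cases k <;> fin_cases l <;>
        simp [diagGL, transvectionGL, Matrix.transvection, Matrix.mul_apply, Fin.sum_univ_two,
          Matrix.single_apply, Matrix.one_apply]
    · refine ⟨diagGL (1, Units.mk0 θ h0), ?_⟩
      ext1
      ext k l
      fin_cases k <;> fin_cases l <;>
        simp [diagGL, transvectionGL, Matrix.transvection, Matrix.mul_apply, Fin.sum_univ_two,
          Matrix.single_apply, Matrix.one_apply]
    · exact absurd rfl hij
  have hadd : ∀ c d : E, transvectionGL i j hij (c + d)
      = transvectionGL i j hij c * transvectionGL i j hij d := fun c d =>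
    Units.ext (Matrix.transvection_mul_transvection_same i j hij c d).symm
  have hsub : θ - 1 ≠ 0 := sub_ne_zero.mpr h1
  obtain ⟨g, hg⟩ := hconj (c / (θ - 1))
  have hc : θ * (c / (θ - 1)) = c + c / (θ - 1) := by
    field_simp
    ring
  have h := congrArg χ hg
  rw [hc, hadd, map_mul, map_mul, map_mul, mul_comm] at h
  exact mul_eq_right.mp (mul_left_cancel h)

/-- Every character of `GL_2(E)` factors through the determinant if `E` has more than two
elements. -/
lemma char_eq_detChar (χ : GL (Fin 2) E →* ℂˣ) {θ : E} (h0 : θ ≠ 0) (h1 : θ ≠ 1)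
    (g : GL (Fin 2) E) : χ g = detChar χ (Matrix.GeneralLinearGroup.det g) := by
  suffices h : ∀ M : Matrix (Fin 2) (Fin 2) E, M.det ≠ 0 → ∀ g : GL (Fin 2) E, g.val = M →
      χ g = detChar χ (Matrix.GeneralLinearGroup.det g) from
    h g.val (by simpa using (Matrix.GeneralLinearGroup.det g).ne_zero) g rfl
  intro M hM
  refine Matrix.diagonal_transvection_induction_of_det_ne_zero
    (fun M => ∀ g : GL (Fin 2) E, g.val = M →
      χ g = detChar χ (Matrix.GeneralLinearGroup.det g)) M hM ?_ ?_ ?_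
  · intro D hD g hg
    rw [Matrix.det_diagonal, Fin.prod_univ_two, mul_ne_zero_iff] at hD
    have hg' : g = diagGL (Units.mk0 _ hD.1, Units.mk0 _ hD.2) := by
      ext1
      rw [hg]
      ext i j
      fin_cases i <;> fin_cases j <;> simp [diagGL]
    rw [hg', char_diagGL, ← map_mul]
    congr 1
    ext1
    simp [diagGL]
  · rintro ⟨i, j, hij, c⟩ g hg
    have hg' : g = transvectionGL i j hij c := Units.ext hg
    have hdet : Matrix.GeneralLinearGroup.det g = 1 := by
      ext1
      rw [Matrix.GeneralLinearGroup.val_det_apply, hg, Matrix.TransvectionStruct.det, Units.val_one]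
    rw [hdet, map_one, hg', char_transvectionGL χ h0 h1]
  · intro A B hA hB hPA hPB g hg
    let a := Matrix.GeneralLinearGroup.mkOfDetNeZero A hA
    let b := Matrix.GeneralLinearGroup.mkOfDetNeZero B hB
    have hab : g = a * b := Units.ext hg
    rw [hab, map_mul, map_mul, map_mul, hPA a rfl, hPB b rfl]

lemma det_map_algebraMap {F : Type*} [Field F] [Algebra F E] (g : GL (Fin 2) F) :
    Matrix.GeneralLinearGroup.det (Matrix.GeneralLinearGroup.map (algebraMap F E) g)
      = unitsMap F E (Matrix.GeneralLinearGroup.det g) := by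
  ext1
  exact (RingHom.map_det (algebraMap F E) g.val).symm

end Character

/-! ### Bases of `E ⊕ E` and orbits of `GL_2(E)` on planes -/

section Bases

variable {F E : Type*} [Field F] [Field E] [Algebra F E]

/-- The change of basis matrix from `b` to `b'`. -/
def changeGL (b b' : Module.Basis (Fin 2 ⊕ Fin 2) F (Fin 2 → E)) : GL (Fin 2 ⊕ Fin 2) F where
  val := b'.toMatrix b
  inv := b.toMatrix b'
  val_inv := Module.Basis.toMatrix_mul_toMatrix_flip _ _
  inv_val := Module.Basis.toMatrix_mul_toMatrix_flip _ _

lemma embGL_val (b : Module.Basis (Fin 2 ⊕ Fin 2) F (Fin 2 → E)) (h : GL (Fin 2) E) :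
    (embGL b h).val = LinearMap.toMatrix b b ((Matrix.toLin' h.val).restrictScalars F) := rfl

lemma changeGL_conj_val (b b' b'' : Module.Basis (Fin 2 ⊕ Fin 2) F (Fin 2 → E))
    (h : GL (Fin 2) E) :
    (changeGL b b'' * embGL b h * (changeGL b b')⁻¹).val
      = LinearMap.toMatrix b' b'' ((Matrix.toLin' h.val).restrictScalars F) := by
  rw [Units.val_mul, Units.val_mul, embGL_val]
  exact basis_toMatrix_mul_linearMap_toMatrix_mul_basis_toMatrix _ _ _ _ _

lemma changeGL_conj (b b' : Module.Basis (Fin 2 ⊕ Fin 2) F (Fin 2 → E)) (h : GL (Fin 2) E) :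
    changeGL b b' * embGL b h * (changeGL b b')⁻¹ = embGL b' h :=
  Units.ext (changeGL_conj_val b b' b' h)

/-- Elements of `GL_4(F)` are thus named by bases, and their cosets modulo `P22 F` by the planes
spanned by the first halves. -/
lemma exists_changeGL_eq (b : Module.Basis (Fin 2 ⊕ Fin 2) F (Fin 2 → E))
    (g : GL (Fin 2 ⊕ Fin 2) F) : ∃ b', changeGL b b' = g := by
  have hu : IsUnit (g⁻¹).val.det := (Matrix.isUnit_iff_isUnit_det _).mp (g⁻¹).isUnit
  refine ⟨b.map (Matrix.toLinearEquiv b (g⁻¹).val hu), ?_⟩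
  rw [← inv_inj]
  ext1
  change b.toMatrix _ = _
  ext i j
  have := congrFun (congrFun (LinearMap.toMatrix_toLin b b (g⁻¹).val) i) j
  rw [LinearMap.toMatrix_apply] at this
  rw [← this]
  rfl

lemma toMatrix_eq_of_apply (b : Module.Basis (Fin 2 ⊕ Fin 2) F (Fin 2 → E))
    (T : (Fin 2 → E) →ₗ[F] (Fin 2 → E)) (M : Matrix (Fin 2 ⊕ Fin 2) (Fin 2 ⊕ Fin 2) F)
    (h : ∀ j, T (b j) = ∑ i, M i j • b i) : LinearMap.toMatrix b b T = M := by
  rw [← LinearMap.toMatrix_toLin b b M]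
  congr 1
  exact b.ext fun j => by rw [h, Matrix.toLin_self]

/-- The identification of the index set of a basis of `E ⊕ E` with pairs. -/
def sumFinEquiv : Fin 2 ⊕ Fin 2 ≃ (Σ _ : Fin 2, Fin 2) where
  toFun := Sum.elim (fun i => ⟨0, i⟩) (fun i => ⟨1, i⟩)
  invFun p := if p.1 = 0 then Sum.inl p.2 else Sum.inr p.2
  left_inv := by decide
  right_inv := by decide

/-- The transposition of the two indices. -/
def sigmaSwap : (Σ _ : Fin 2, Fin 2) ≃ (Σ _ : Fin 2, Fin 2) where
  toFun p := ⟨p.2, p.1⟩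
  invFun p := ⟨p.2, p.1⟩

variable (e : Module.Basis (Fin 2) F E)

/-- The basis of `E ⊕ E` whose first half spans the line `E ⊕ 0`. -/
def lineBasis : Module.Basis (Fin 2 ⊕ Fin 2) F (Fin 2 → E) :=
  (Pi.basis fun _ : Fin 2 => e).reindex sumFinEquiv.symm

/-- The basis of `E ⊕ E` whose first half spans `F e₀ ⊕ F e₀`. -/
def formBasis : Module.Basis (Fin 2 ⊕ Fin 2) F (Fin 2 → E) :=
  (Pi.basis fun _ : Fin 2 => e).reindex (sumFinEquiv.trans sigmaSwap).symm

lemma lineBasis_inl (i : Fin 2) : lineBasis e (Sum.inl i) = Pi.single 0 (e i) := by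
  simp [lineBasis, sumFinEquiv]

lemma lineBasis_inr (i : Fin 2) : lineBasis e (Sum.inr i) = Pi.single 1 (e i) := by
  simp [lineBasis, sumFinEquiv]

lemma formBasis_inl (i : Fin 2) : formBasis e (Sum.inl i) = Pi.single i (e 0) := by
  simp [formBasis, sumFinEquiv, sigmaSwap]

lemma formBasis_inr (i : Fin 2) : formBasis e (Sum.inr i) = Pi.single i (e 1) := by
  simp [formBasis, sumFinEquiv, sigmaSwap]

lemma sum_leftMulMatrix_smul (a : E) (j : Fin 2) :
    ∑ i, Algebra.leftMulMatrix e a i j • e i = a * e j := by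
  simp only [Algebra.leftMulMatrix_eq_repr_mul]
  exact e.sum_repr _

lemma embGL_lineBasis (a d : Eˣ) :
    embGL (lineBasis e) (diagGL (a, d)) = blockDiag (torus e a) (torus e d) := by
  ext1
  rw [embGL_val]
  refine toMatrix_eq_of_apply _ _ _ ?_
  have hs : ∀ (k : Fin 2) (x y : F),
      (Pi.single k (x • e 0 + y • e 1) : Fin 2 → E)
        = x • (Pi.single k (e 0) : Fin 2 → E) + y • (Pi.single k (e 1) : Fin 2 → E) := by
    intro k x y
    rw [Pi.single_add, Pi.single_smul, Pi.single_smul]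
  rintro (j | j)
  · have h := sum_leftMulMatrix_smul e (a : E) j
    simp only [Fintype.sum_sum_type, lineBasis_inl, lineBasis_inr, blockDiag,
      Matrix.fromBlocks_apply₁₁, Matrix.fromBlocks_apply₂₁, torus_val, Matrix.zero_apply, zero_smul,
      Finset.sum_const_zero, add_zero, Fin.sum_univ_two] at h ⊢
    rw [← hs, h]
    ext k
    fin_cases k <;> simp [diagGL]
  · have h := sum_leftMulMatrix_smul e (d : E) j
    simp only [Fintype.sum_sum_type, lineBasis_inl, lineBasis_inr, blockDiag,
      Matrix.fromBlocks_apply₁₂, Matrix.fromBlocks_apply₂₂, torus_val, Matrix.zero_apply, zero_smul,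
      Finset.sum_const_zero, zero_add, Fin.sum_univ_two] at h ⊢
    rw [← hs, h]
    ext k
    fin_cases k <;> simp [diagGL]

/-- A matrix over `F` acts alike on the `F`-forms with coordinates in `F e₀` and in `F e₁`, whence
two equal blocks. -/
lemma embGL_formBasis (g : GL (Fin 2) F) :
    embGL (formBasis e) (Matrix.GeneralLinearGroup.map (algebraMap F E) g) = blockDiag g g := by
  ext1
  rw [embGL_val]
  refine toMatrix_eq_of_apply _ _ _ ?_
  rintro (j | j)
  · simp only [Fintype.sum_sum_type, formBasis_inl, formBasis_inr, blockDiag,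
      Matrix.fromBlocks_apply₁₁, Matrix.fromBlocks_apply₂₁, Matrix.zero_apply, zero_smul,
      Finset.sum_const_zero, add_zero, Fin.sum_univ_two]
    ext k
    fin_cases k <;> simp [Algebra.smul_def, Matrix.mulVec_single]
  · simp only [Fintype.sum_sum_type, formBasis_inl, formBasis_inr, blockDiag,
      Matrix.fromBlocks_apply₁₂, Matrix.fromBlocks_apply₂₂, Matrix.zero_apply, zero_smul,
      Finset.sum_const_zero, zero_add, Fin.sum_univ_two]
    ext k
    fin_cases k <;> simp [Algebra.smul_def, Matrix.mulVec_single]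

/-- `GL_2(E)` has two orbits on the planes of `E ⊕ E` over `F`: the lines over `E` and the planes
that generate `E ⊕ E` over `E`. -/
lemma exists_map_basis (h0 : e 0 = 1) (b : Module.Basis (Fin 2 ⊕ Fin 2) F (Fin 2 → E)) :
    ∃ k : GL (Fin 2) E,
      (∀ i, Matrix.toLin' k.val (formBasis e (Sum.inl i)) ∈
        Submodule.span F (Set.range fun j => b (Sum.inl j))) ∨
      (∀ i, Matrix.toLin' k.val (lineBasis e (Sum.inl i)) ∈
        Submodule.span F (Set.range fun j => b (Sum.inl j))) := by
  set u := b (Sum.inl 0) with hu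
  set v := b (Sum.inl 1) with hv
  have hmemu : u ∈ Submodule.span F (Set.range fun j => b (Sum.inl j)) :=
    Submodule.subset_span ⟨0, rfl⟩
  have hmemv : v ∈ Submodule.span F (Set.range fun j => b (Sum.inl j)) :=
    Submodule.subset_span ⟨1, rfl⟩
  by_cases hdet : u 0 * v 1 - v 0 * u 1 = 0
  · have hu0 : u ≠ 0 := b.ne_zero _
    obtain ⟨⟨α, hα⟩, k, hk0, hk1⟩ : (∃ α : E, v = α • u) ∧
        ∃ k : GL (Fin 2) E, k.val 0 0 = u 0 ∧ k.val 1 0 = u 1 := by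
      by_cases hu00 : u 0 = 0
      · have hu1 : u 1 ≠ 0 := fun h => hu0 (by ext l; fin_cases l <;> simp [hu00, h])
        have hv0 : v 0 = 0 := by simpa [hu00, hu1] using hdet
        refine ⟨⟨v 1 / u 1, ?_⟩,
          Matrix.GeneralLinearGroup.mkOfDetNeZero !![u 0, 1; u 1, 0] (by simpa using hu1),
          rfl, rfl⟩
        ext l
        fin_cases l <;> simp [hv0, hu00, hu1]
      · refine ⟨⟨v 0 / u 0, ?_⟩,
          Matrix.GeneralLinearGroup.mkOfDetNeZero !![u 0, 0; u 1, 1] (by simpa using hu00),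
          rfl, rfl⟩
        ext l
        fin_cases l
        · simp [hu00]
        · simp only [Fin.mk_one, Pi.smul_apply, smul_eq_mul]
          field_simp
          linear_combination hdet
    -- Since `u`, `v` are independent over `F`, `α` is not in `F`; so `1, α` span `E` and the plane
    -- is the whole line `E u`.
    have hli : LinearIndependent F ![1, α] := by
      rw [LinearIndependent.pair_iff' one_ne_zero]
      intro a ha
      have h1 : v = a • u := by rw [hα, ← ha, smul_assoc, one_smul]
      have h2 := congrArg (fun x => b.repr x (Sum.inl 1)) h1
      simp [hu, hv] at h2
    have hspan := hli.span_eq_top_of_card_eq_finrank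
      (by rw [Module.finrank_eq_card_basis e])
    refine ⟨k, Or.inr fun i => ?_⟩
    have hi : e i ∈ Submodule.span F (Set.range ![1, α]) := hspan ▸ Submodule.mem_top
    rw [Matrix.range_cons, Matrix.range_cons, Matrix.range_empty, Set.union_empty,
      Set.singleton_union, Submodule.mem_span_pair] at hi
    obtain ⟨x, y, hxy⟩ := hi
    have : Matrix.toLin' k.val (lineBasis e (Sum.inl i)) = x • u + y • v := by
      rw [lineBasis_inl, ← hxy, hα]
      ext l
      fin_cases l <;> simp [hk0, hk1, Algebra.smul_def] <;> ring
    rw [this]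
    exact Submodule.add_mem _ (Submodule.smul_mem _ _ hmemu) (Submodule.smul_mem _ _ hmemv)
  · let k := Matrix.GeneralLinearGroup.mkOfDetNeZero !![u 0, v 0; u 1, v 1]
      (by rw [Matrix.det_fin_two_of]; exact hdet)
    refine ⟨k, Or.inl fun i => ?_⟩
    rw [formBasis_inl, h0]
    have hk : k.val = !![u 0, v 0; u 1, v 1] := rfl
    fin_cases i
    · convert hmemu using 1
      ext l
      fin_cases l <;> simp [hk]
    · convert hmemv using 1
      ext l
      fin_cases l <;> simp [hk]

end Bases

/-! ### Restriction of equivariant functionals to the orbits -/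

section Mackey

variable {F E : Type*} [Field F] [Field E] [Algebra F E]
  {b : Module.Basis (Fin 2 ⊕ Fin 2) F (Fin 2 → E)}
  {V₁ V₂ : Type*} [AddCommGroup V₁] [Module ℂ V₁] [AddCommGroup V₂] [Module ℂ V₂]
  {σ₁ : Representation ℂ (GL (Fin 2) F) V₁} {σ₂ : Representation ℂ (GL (Fin 2) F) V₂}
  {χ : GL (Fin 2) E →* ℂˣ}

/-- The pairing of `σ₁` and `σ₂` obtained from an equivariant functional on the induced
representation by evaluation at a basis of `E ⊕ E`. -/
def evalForm (b' : Module.Basis (Fin 2 ⊕ Fin 2) F (Fin 2 → E)) :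
    IntertwiningMap ((parabolicInd σ₁ σ₂).comp (embGL b)) (charRep χ) →ₗ[ℂ]
      (V₁ →ₗ[ℂ] V₂ →ₗ[ℂ] ℂ) where
  toFun f := (TensorProduct.mk ℂ V₁ V₂).compr₂
    (f.toLinearMap ∘ₗ IndV.mk (P22 F).subtype (inflation σ₁ σ₂) (changeGL b b'))
  map_add' f g := by ext; simp
  map_smul' r f := by ext; simp

variable (f : IntertwiningMap ((parabolicInd σ₁ σ₂).comp (embGL b)) (charRep χ))

lemma evalForm_apply (b' : Module.Basis (Fin 2 ⊕ Fin 2) F (Fin 2 → E)) (x : V₁) (y : V₂) :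
    evalForm b' f x y
      = f (IndV.mk (P22 F).subtype (inflation σ₁ σ₂) (changeGL b b') (x ⊗ₜ[ℂ] y)) := rfl

lemma intertwining_mk (g : GL (Fin 2 ⊕ Fin 2) F) (h : GL (Fin 2) E) (a : TensorProduct ℂ V₁ V₂) :
    f (IndV.mk (P22 F).subtype (inflation σ₁ σ₂) (g * (embGL b h)⁻¹) a)
      = χ h * f (IndV.mk (P22 F).subtype (inflation σ₁ σ₂) g a) := by
  rw [← ind_mk]
  exact IntertwiningMap.isIntertwining _ _ f h _

/-- `changeGL b b'` conjugates `embGL b h` into the Levi subgroup, so `h` acts through `σ₁ ⊗ σ₂` on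
one side and through `χ` on the other. -/
lemma evalForm_equivariant (b' : Module.Basis (Fin 2 ⊕ Fin 2) F (Fin 2 → E)) (h : GL (Fin 2) E)
    (A D : GL (Fin 2) F) (hh : embGL b' h = blockDiag A D) (x : V₁) (y : V₂) :
    evalForm b' f (σ₁ A x) (σ₂ D y) = χ h * evalForm b' f x y := by
  rw [evalForm_apply, evalForm_apply, ← intertwining_mk]
  have hmk := indV_mk_mul (φ := (P22 F).subtype) (ρ := inflation σ₁ σ₂)
    ⟨blockDiag A D, blockDiag_mem A D⟩ (changeGL b b' * (embGL b h)⁻¹) (x ⊗ₜ[ℂ] y)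
  have h1 : blockDiag A D * (changeGL b b' * (embGL b h)⁻¹) = changeGL b b' := by
    rw [← hh, ← changeGL_conj b b' h]
    group
  have h2 : inflation σ₁ σ₂ ⟨blockDiag A D, blockDiag_mem A D⟩ (x ⊗ₜ[ℂ] y)
      = σ₁ A x ⊗ₜ[ℂ] σ₂ D y := by
    simp [inflation, leviFst_blockDiag, leviSnd_blockDiag]
  rw [h2] at hmk
  change IndV.mk _ _ (blockDiag A D * (changeGL b b' * (embGL b h)⁻¹)) _ = _ at hmk
  rw [h1] at hmk
  rw [hmk]

/-- If `k` maps the plane of `b'` into that of `b''`, its matrix `p` between these bases is block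
upper triangular, so both base changes lie in one double coset. -/
lemma intertwining_eq_zero_of_evalForm (b' b'' : Module.Basis (Fin 2 ⊕ Fin 2) F (Fin 2 → E))
    (k : GL (Fin 2) E)
    (hk : ∀ i, Matrix.toLin' k.val (b' (Sum.inl i)) ∈
        Submodule.span F (Set.range fun j => b'' (Sum.inl j)))
    (hf : evalForm b' f = 0) (a : TensorProduct ℂ V₁ V₂) :
    f (IndV.mk (P22 F).subtype (inflation σ₁ σ₂) (changeGL b b'') a) = 0 := by
  set p := changeGL b b'' * embGL b k * (changeGL b b')⁻¹ with hp
  have hpmem : p ∈ P22 F := by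
    change p.val.toBlocks₂₁ = 0
    ext i j
    rw [hp, changeGL_conj_val, Matrix.toBlocks₂₁, Matrix.of_apply, LinearMap.toMatrix_apply]
    have hker : Submodule.span F (Set.range fun j => b'' (Sum.inl j))
        ≤ LinearMap.ker (b''.coord (Sum.inr i)) := by
      rw [Submodule.span_le]
      rintro _ ⟨l, rfl⟩
      simp
    exact hker (hk j)
  have hzero : ∀ a, f (IndV.mk (P22 F).subtype (inflation σ₁ σ₂) (changeGL b b') a) = 0 := by
    intro a
    have : f.toLinearMap ∘ₗ IndV.mk (P22 F).subtype (inflation σ₁ σ₂) (changeGL b b') = 0 :=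
      TensorProduct.ext hf
    exact LinearMap.congr_fun this a
  have h1 : changeGL b b'' = p * changeGL b b' * (embGL b k)⁻¹ := by
    rw [hp]; group
  have h2 := indV_mk_mul (φ := (P22 F).subtype) (ρ := inflation σ₁ σ₂) ⟨p, hpmem⟩ (changeGL b b')
    (inflation σ₁ σ₂ ⟨p, hpmem⟩⁻¹ a)
  rw [← Module.End.mul_apply, ← map_mul, mul_inv_cancel, map_one, Module.End.one_apply] at h2
  change IndV.mk _ _ (p * changeGL b b') a = _ at h2
  rw [h1, intertwining_mk, h2, hzero, mul_zero]

/-- An equivariant functional is determined by its values on the two orbits. -/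
lemma eq_zero_of_evalForm {e : Module.Basis (Fin 2) F E} (h0 : e 0 = 1)
    (hform : evalForm (formBasis e) f = 0) (hline : evalForm (lineBasis e) f = 0) : f = 0 := by
  ext1
  refine IndV.hom_ext _ _ fun g => LinearMap.ext fun a => ?_
  obtain ⟨b'', rfl⟩ := exists_changeGL_eq b g
  obtain ⟨k, hk | hk⟩ := exists_map_basis e h0 b''
  · exact intertwining_eq_zero_of_evalForm f _ b'' k hk hform a
  · exact intertwining_eq_zero_of_evalForm f _ b'' k hk hline a

end Mackey

/-- A space that embeds in a sum of two spaces by maps of rank at most one, of which at least one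
vanishes, is at most one-dimensional. -/
lemma rank_le_one_of_exclusive_maps {K X Y Z : Type*} [Field K] [AddCommGroup X] [Module K X]
    [AddCommGroup Y] [Module K Y] [AddCommGroup Z] [Module K Z] (Φ : X →ₗ[K] Y) (Λ : X →ₗ[K] Z)
    (hinj : ∀ f, Φ f = 0 → Λ f = 0 → f = 0)
    (hΦ : ∀ f f', Φ f ≠ 0 → ∃ r : K, r • Φ f = Φ f')
    (hΛ : ∀ f f', Λ f ≠ 0 → ∃ r : K, r • Λ f = Λ f')
    (hexcl : ∀ f f', Φ f ≠ 0 → Λ f' = 0) : Module.rank K X ≤ 1 := by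
  rw [rank_le_one_iff]
  by_cases hz : ∃ f₀, Φ f₀ ≠ 0
  · obtain ⟨f₀, hf₀⟩ := hz
    refine ⟨f₀, fun f => ?_⟩
    obtain ⟨r, hr⟩ := hΦ f₀ f hf₀
    refine ⟨r, sub_eq_zero.mp (hinj _ ?_ (hexcl f₀ _ hf₀))⟩
    rw [map_sub, map_smul, hr, sub_self]
  · push Not at hz
    by_cases hz' : ∃ f₀, Λ f₀ ≠ 0
    · obtain ⟨f₀, hf₀⟩ := hz'
      refine ⟨f₀, fun f => ?_⟩
      obtain ⟨r, hr⟩ := hΛ f₀ f hf₀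
      refine ⟨r, sub_eq_zero.mp (hinj _ (hz _) ?_)⟩
      rw [map_sub, map_smul, hr, sub_self]
    · push Not at hz'
      exact ⟨0, fun f => ⟨0, by rw [hinj f (hz f) (hz' f), smul_zero]⟩⟩

end GLFour

end

/-! ### Multiplicity one -/

theorem mainTheorem2 {F E : Type*} [Field F] [Finite F] [Field E] [Algebra F E]
    (hE : Module.finrank F E = 2)
    (b : Module.Basis (Fin 2 ⊕ Fin 2) F (Fin 2 → E))
    {V₁ V₂ : Type*} [AddCommGroup V₁] [Module ℂ V₁] [AddCommGroup V₂] [Module ℂ V₂]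
    (σ₁ : Representation ℂ (GL (Fin 2) F) V₁) (σ₂ : Representation ℂ (GL (Fin 2) F) V₂)
    (hσ₁ : σ₁.IsIrreducible) (hσ₂ : σ₂.IsIrreducible)
    (hπ : (GLFour.parabolicInd σ₁ σ₂).IsIrreducible)
    (χ : GL (Fin 2) E →* ℂˣ) :
    Module.rank ℂ
      (Representation.IntertwiningMap
        ((GLFour.parabolicInd σ₁ σ₂).comp (GLFour.embGL b)) (GLFour.charRep χ)) ≤ 1 := by
  classical
  obtain ⟨e, t, n, h0, h1⟩ := GLFour.exists_quadratic_basis hE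
  have : FiniteDimensional F E := Module.finite_of_finrank_eq_succ hE
  have : Finite E := Module.finite_of_finite F
  have : Fintype Eˣ := Fintype.ofFinite _
  -- The element `e 1` differs from `0` and from `1 = e 0`, so `E` is large enough for `χ` to factor
  -- through the determinant.
  have hχ : ∀ g, χ (Matrix.GeneralLinearGroup.map (algebraMap F E) g)
      = GLFour.detChar χ (GLFour.unitsMap F E (Matrix.GeneralLinearGroup.det g)) := fun g => by
    rw [GLFour.char_eq_detChar χ (θ := e 1) (e.ne_zero 1)
      (fun h => zero_ne_one (e.injective (h0.trans h.symm))), GLFour.det_map_algebraMap]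
  have hopen : ∀ f : Representation.IntertwiningMap
      ((GLFour.parabolicInd σ₁ σ₂).comp (GLFour.embGL b)) (GLFour.charRep χ), ∀ g x y,
      GLFour.evalForm (GLFour.formBasis e) f (σ₁ g x) (σ₂ g y)
        = (χ.comp (Matrix.GeneralLinearGroup.map (algebraMap F E)) g : ℂˣ) *
          GLFour.evalForm (GLFour.formBasis e) f x y := fun f g x y =>
    GLFour.evalForm_equivariant f _ _ g g (GLFour.embGL_formBasis e g) x y
  have hclosed : ∀ f : Representation.IntertwiningMap
      ((GLFour.parabolicInd σ₁ σ₂).comp (GLFour.embGL b)) (GLFour.charRep χ), ∀ a d x y,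
      GLFour.evalForm (GLFour.lineBasis e) f (σ₁ (GLFour.torus e a) x) (σ₂ (GLFour.torus e d) y)
        = GLFour.detChar χ a * GLFour.detChar χ d *
          GLFour.evalForm (GLFour.lineBasis e) f x y := fun f a d x y => by
    rw [GLFour.evalForm_equivariant f _ _ _ _ (GLFour.embGL_lineBasis e a d) x y,
      GLFour.char_diagGL, Units.val_mul]
  have hexcl : ∀ f f' : Representation.IntertwiningMap
      ((GLFour.parabolicInd σ₁ σ₂).comp (GLFour.embGL b)) (GLFour.charRep χ),
      GLFour.evalForm (GLFour.formBasis e) f ≠ 0 →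
        GLFour.evalForm (GLFour.lineBasis e) f' = 0 := by
    intro f f' hf
    by_contra hf'
    have hB : ∀ g x y, GLFour.evalForm (GLFour.formBasis e) f (σ₁ g x) (σ₂ g y)
        = GLFour.detChar χ (GLFour.unitsMap F E (Matrix.GeneralLinearGroup.det g)) *
          GLFour.evalForm (GLFour.formBasis e) f x y := fun g x y =>
      (hopen f g x y).trans (congrArg (fun z : ℂˣ => (z : ℂ) * _) (hχ g))
    obtain ⟨A, hA⟩ := GLFour.exists_equiv_of_forms h0 h1 hσ₁ hσ₂ hB hf (hclosed f') hf'
    have := GLFour.nontrivial_of_irreducible hσ₁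
    have := GLFour.nontrivial_of_irreducible hσ₂
    exact GLFour.not_irreducible_of_equiv A hA hπ
  exact GLFour.rank_le_one_of_exclusive_maps (GLFour.evalForm (GLFour.formBasis e))
    (GLFour.evalForm (GLFour.lineBasis e)) (fun f => GLFour.eq_zero_of_evalForm f h0)
    (fun f f' => GLFour.form_unique hσ₁ hσ₂ (hopen f) (hopen f'))
    (fun f f' => GLFour.torus_form_unique h0 h1 hσ₁ hσ₂ (hclosed f) (hclosed f')) hexcl
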